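/- **Preclones.** A *preclone* is a many-sorted algebra $S=((S_n)_{n\ge0},\bullet,\mathbf 1)$ with $\mathbf 1\in S_1$ and a composition $f\cdot(g_1\oplus\cdots\oplus g_n)\in S_{m_1+\cdots+m_n}$ for $f\in S_n$, $g_i\in S_{m_i}$, satisfying the unit laws $\mathbf 1\cdot f=f=f\cdot(\mathbf 1\oplus\cdots\oplus\mathbf 1)$ and associativity. A *$pg$-pair* $(S,A)$ is a preclone $S$ with a generating set $A$, $A_n=A\cap S_n$; it is *finitary* if every $S_n$ and $A$ are finite. Morphisms of $pg$-pairs are preclone morphisms mapping generators to generators. A $pg$-pair $(T,B)$ *recognizes* $L\subseteq S_k$, where $(S,A)$ is a $pg$-pair, if $L=\varphi^{-1}(P)$ for some morphism $\varphi\colon(S,A)\to(T,B)$ and some $P\subseteq T_k$; it recognizes several languages *simultaneously* if a single $\varphi$ works for all of them. For a ranked alphabet $\Sigma$ (finite, $\Sigma_n$ being the letters of rank $n$), $\Sigma M$ is the free preclone on $\Sigma$: $\Sigma M_n$ is the set of finite $\Sigma$-labelled ordered trees whose leaves may also be labelled by the variables $v_1,\dots,v_n$, each occurring exactly once and in this left-to-right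 order; composition is substitution. $\mathsf{NV}(t)$ is the set of nodes of $t$ labelled in $\Sigma$. Languages in $\Sigma M_k$ are recognized with respect to the $pg$-pair $(\Sigma M,\Sigma)$. **Block product.** For $k,n\ge0$ let $I_{k,n}$ be the set of contexts $(u,k_1,v,k_2)$ with $u\in T_{k_1+1+k_2}$ and $v=v_1\oplus\cdots\oplus v_n$ an $n$-tuple of elements of $T$ of total rank $k-k_1-k_2\ge 0$. Then $(S\,\Box_k T)_n=S_n^{I_{k,n}}\times T_n$, with unit $(F_{\mathbf 1},\mathbf 1)$, where $F_{\mathbf 1}$ is the constant map $\mathbf 1$, and composition $$(F,f)\cdot\bigoplus_{i=1}^n(G_i,g_i)=(Q,f\cdot g),\qquad Q(u,k_1,v,k_2)=F(u,k_1,g\cdot v,k_2)\cdot\big(G_1(C_1)\oplus\cdots\oplus G_n(C_n)\big),$$ where $g=\bigoplus_i g_i$, $v=\bar v_1\oplus\cdots\oplus\bar v_n$ is cut according to the ranks of the $g_i$, and $C_i=(c_i,p_1,\bar v_i,p_2)$ with $c_i=u\cdot(\mathbf k_1\oplus f\cdot(g_1\cdot\bar v_1\oplus\cdots\oplus\mathbf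 1\oplus\cdots\oplus g_n\cdot\bar v_n)\oplus\mathbf k_2)$ ($\mathbf 1$ in position $i$, $\mathbf{k}_j$ the sum of $k_j$ copies of $\mathbf 1$), $p_1=k_1+\sum_{j<i}\mathrm{rank}(\bar v_j)$ and $p_2=k_2+\sum_{j>i}\mathrm{rank}(\bar v_j)$. The $pg$-pair $(S,A)\,\Box_k(T,B)$ is the sub-preclone of $S\,\Box_kT$ generated by the pairs $(F,g)$ with, for some $n$, $g\in B_n$ and $F(c)\in A_n$ for all $c\in I_{k,n}$, with these generators. **Logic.** Formulas of rank $k$ over $\Sigma$ are built from the atomic formulas $P_\sigma(x)$ ($x$ is labelled $\sigma$), $x<y$ ($y$ is a proper descendant of $x$), $\mathsf{Succ}_i(x,y)$ ($y$ is the $i$-th successor of $x$), $\mathsf{root}(x)$, $\mathsf{max}_{i,j}(x)$ (the $i$-th successor of $x$ is labelled $v_j$), $\mathsf{left}_j(x)$, $\mathsf{right}_j(x)$ (the last variable to the left, resp. the first variable to the right, of the frontier of the subtree at $x$ is $v_j$), with $1\le j\le k$, by Boolean connectives and constants and Lindström quantifiers. First-order variables are interpreted by nodes in $\mathsf{NV}(t)$,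 $t\in\Sigma M_k$. Let $\Delta$ be a ranked alphabet with $\Delta_n\neq\emptyset$ whenever $\Sigma_n\ne\emptyset$. A family $\langle\varphi_\delta\rangle_{\delta\in\Delta}$ of rank $k$ formulas over $\Sigma$ is *deterministic with respect to $x$* if for all $t\in\Sigma M_k$, all $n$ and every interpretation $\lambda$ of the free variables that maps $x$ to a rank $n$ node of $t$, $(t,\lambda)$ satisfies exactly one $\varphi_\delta$ with $\delta\in\Delta_n$. For such a family and $K\subseteq\Delta M_k$, $(t,\lambda)\models Q_Kx\cdot\langle\varphi_\delta\rangle_{\delta\in\Delta}$ iff the characteristic tree $\bar t_\lambda$ is in $K$; it is obtained from $t$ by relabelling each rank $n$ node $p\in\mathsf{NV}(t)$ by the unique $\delta\in\Delta_n$ such that $(t,\lambda[x\mapsto p])\models\varphi_\delta$. For a finite set $Z$ of first-order variables let $(\Sigma_Z)_n=\Sigma_n\times\mathcal P(Z)$. A $Z$-structure is a tree over $\Sigma_Z$ in which each $z\in Z$ occurs in the label of exactly one node; $Z$-structures correspond to pairs $(t,\lambda)$ with $t\in\Sigma M$, $\lambda\colon Z\to\mathsf{NV}(t)$. For a rank $k$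 formula $\varphi$ with free variables in $Z$, $L_\varphi\subseteq\Sigma_ZM_k$ is the set of $Z$-structures of rank $k$ satisfying $\varphi$. (For $k=1$ and $Z=\emptyset$ the one-node tree $\mathbf 1=v_1$ counts as a $\emptyset$-structure; it is its own characteristic tree, so it satisfies $Q_Kx\cdot\langle\varphi_\delta\rangle$ iff $\mathbf 1\in K$.) **Proposition.** Let $Y$ be a finite set of first-order variables and let $y\notin Y$. Let $\langle\varphi_\delta\rangle_{\delta\in\Delta}$ be a family of rank $k$ formulas over $\Sigma$, with free variables in $Y\cup\{y\}$, deterministic with respect to $y$, let $K\subseteq\Delta M_k$ and let $\varphi=Q_Ky\cdot\langle\varphi_\delta\rangle_{\delta\in\Delta}$. Assume that $Y=\emptyset$ or that $\Sigma$ has a letter of rank $0$ or $1$. Let $(S,A)$ be a $pg$-pair recognizing $K$, and let $(T,B)$ be a $pg$-pair recognizing simultaneously the languages $L_{\varphi_\delta}\subseteq\Sigma_{Y\cup\{y\}}M_k$ ($\delta\in\Delta$). Then $L_\varphi\subseteq\Sigma_YM_k$ is recognized by $(S,A)\,\Box_k(T,B)$; moreover, this $pg$-pair is finitary if $(S,A)$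 and $(T,B)$ are. -/

import Mathlib

universe u v

namespace TreeLogic

/-! ### Preclones -/

/-- A preclone, presented by the disjoint union `Elem` of its sorts: the sort `S_n` is the set of
elements of rank `n`.  `comp f g` is `f · (g_0 ⊕ ⋯ ⊕ g_{n-1})` where `n = rank f`; an `n`-tuple
`g_0 ⊕ ⋯ ⊕ g_{n-1}` is a function on `Fin n`.  In `comp_assoc`, `finSigmaFinEquiv ⟨i, j⟩` is the
position of the `j`-th entry of the `i`-th of the consecutive blocks of lengths `rank (g i)`. -/
structure Preclone where
  Elem : Type u
  rank : Elem → ℕ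
  one : Elem
  comp : (f : Elem) → (Fin (rank f) → Elem) → Elem
  rank_one : rank one = 1
  rank_comp : ∀ f g, rank (comp f g) = ∑ i, rank (g i)
  one_comp : ∀ f, comp one (fun _ => f) = f
  comp_one : ∀ f, comp f (fun _ => one) = f
  comp_assoc : ∀ f g h, comp (comp f g) h = comp f (fun i => comp (g i) (fun j =>
    h (Fin.cast (rank_comp f g).symm (finSigmaFinEquiv ⟨i, j⟩))))

namespace Preclone

/-- The sort `S_n`. -/
def Of (S : Preclone.{u}) (n : ℕ) : Type u := {s : S.Elem // S.rank s = n}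

/-- `f · (g_0 ⊕ ⋯ ⊕ g_{n-1})` for `f ∈ S_n`. -/
def act (S : Preclone.{u}) {n : ℕ} (f : S.Of n) (g : Fin n → S.Elem) : S.Elem :=
  S.comp f.1 (fun i => g (Fin.cast f.2 i))

/-- `f · (𝐩 ⊕ w ⊕ 𝐪)`, where `rank f = p + 1 + q`. -/
def plug (S : Preclone.{u}) (f : S.Elem) (p : ℕ) (w : S.Elem) : S.Elem :=
  S.comp f (fun i => if i.val = p then w else S.one)

/-- A morphism of preclones preserves the rank, the unit and the composition. -/
structure Hom (S : Preclone.{u}) (T : Preclone.{v}) where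
  toFun : S.Elem → T.Elem
  rank_map : ∀ s, T.rank (toFun s) = S.rank s
  map_one : toFun S.one = T.one
  map_comp : ∀ f g, toFun (S.comp f g) =
    T.comp (toFun f) (fun i => toFun (g (Fin.cast (rank_map f) i)))

/-- Membership in the least sub-preclone containing `A`. -/
inductive Generated (S : Preclone.{u}) (A : Set S.Elem) : S.Elem → Prop
  | one : Generated S A S.one
  | mem (s : S.Elem) : s ∈ A → Generated S A s
  | comp (f : S.Elem) (g : Fin (S.rank f) → S.Elem) :
      Generated S A f → (∀ i, Generated S A (g i)) → Generated S A (S.comp f g)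

/-- The sub-preclone generated by `A`. -/
def closure (S : Preclone.{u}) (A : Set S.Elem) : Preclone.{u} where
  Elem := {s : S.Elem // S.Generated A s}
  rank s := S.rank s.1
  one := ⟨S.one, .one⟩
  comp f g := ⟨S.comp f.1 (fun i => (g i).1), .comp _ _ f.2 (fun i => (g i).2)⟩
  rank_one := S.rank_one
  rank_comp _ _ := S.rank_comp _ _
  one_comp f := Subtype.ext (S.one_comp f.1)
  comp_one f := Subtype.ext (S.comp_one f.1)
  comp_assoc f g h := Subtype.ext (S.comp_assoc f.1 (fun i => (g i).1) (fun i => (h i).1))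

theorem comp_congr (S : Preclone.{u}) {f f' : S.Elem} {g : Fin (S.rank f) → S.Elem}
    {g' : Fin (S.rank f') → S.Elem} (hf : f = f')
    (hg : ∀ i i', i.val = i'.val → g i = g' i') : S.comp f g = S.comp f' g' := by
  subst hf
  congr 1
  funext i
  exact hg i i rfl

theorem act_congr (S : Preclone.{u}) {n n' : ℕ} {f : S.Of n} {f' : S.Of n'}
    {g : Fin n → S.Elem} {g' : Fin n' → S.Elem} (hf : f.1 = f'.1)
    (hg : ∀ i i', i.val = i'.val → g i = g' i') : S.act f g = S.act f' g' :=
  S.comp_congr hf fun i i' h => hg _ _ (by simpa using h)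

theorem sum_fin_congr {n m : ℕ} (h : n = m) {f : Fin n → ℕ} {g : Fin m → ℕ}
    (hfg : ∀ i j, i.val = j.val → f i = g j) : ∑ i, f i = ∑ j, g j := by
  subst h
  exact Finset.sum_congr rfl fun i _ => hfg i i rfl

theorem rank_act (S : Preclone.{u}) {n : ℕ} (f : S.Of n) (g : Fin n → S.Elem) :
    S.rank (S.act f g) = ∑ i, S.rank (g i) := by
  unfold act
  rw [S.rank_comp]
  exact sum_fin_congr f.2 fun i j h => by congr 2; exact Fin.ext h

theorem finSigma_val {n : ℕ} (m : Fin n → ℕ) (i : Fin n) (j : Fin (m i)) :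
    (finSigmaFinEquiv ⟨i, j⟩ : Fin (∑ i, m i)).val = (∑ a ∈ Finset.Iio i, m a) + j.val := by
  rw [finSigmaFinEquiv_apply]
  congr 1
  symm
  refine Finset.sum_bij' (fun a ha => ⟨a.val, by simpa using ha⟩)
    (fun b _ => Fin.castLE i.2.le b) ?_ ?_ ?_ ?_ ?_
  · intros; simp
  · intro b _
    simp [Fin.lt_def]
  · intros; rfl
  · intros; rfl
  · intros; rfl

theorem sum_sigma {n : ℕ} (m : Fin n → ℕ) (f : Fin (∑ i, m i) → ℕ) :
    ∑ i, ∑ j, f (finSigmaFinEquiv ⟨i, j⟩) = ∑ p, f p := by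
  rw [← Fintype.sum_sigma (fun x : (i : Fin n) × Fin (m i) => f (finSigmaFinEquiv x))]
  exact Equiv.sum_comp finSigmaFinEquiv f

theorem sum_split {n : ℕ} (m : Fin n → ℕ) (i : Fin n) :
    ∑ a, m a = ∑ a ∈ Finset.Iio i, m a + m i + ∑ a ∈ Finset.Ioi i, m a := by
  have h : (Finset.univ : Finset (Fin n)) = (Finset.Iio i ∪ {i}) ∪ Finset.Ioi i := by
    ext a
    simp only [Finset.mem_univ, Finset.mem_union, Finset.mem_Iio, Finset.mem_singleton,
      Finset.mem_Ioi, true_iff]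
    rcases lt_trichotomy a i with h | h | h <;> simp [h]
  rw [h, Finset.sum_union, Finset.sum_union, Finset.sum_singleton]
  · simp
  · rw [Finset.disjoint_left]
    intro a ha hb
    simp only [Finset.mem_union, Finset.mem_Iio, Finset.mem_singleton, Finset.mem_Ioi] at ha hb
    rcases ha with ha | ha
    · exact absurd (ha.trans hb) (lt_irrefl _)
    · exact absurd (ha ▸ hb) (lt_irrefl _)

theorem rank_plug (S : Preclone.{u}) (f : S.Elem) (p q : ℕ) (hf : S.rank f = p + 1 + q)
    (w : S.Elem) : S.rank (S.plug f p w) = p + S.rank w + q := by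
  unfold plug
  rw [S.rank_comp, sum_split _ ⟨p, by omega⟩]
  have h1 : ∀ a ∈ Finset.Iio (⟨p, by omega⟩ : Fin (S.rank f)),
      S.rank (if a.val = p then w else S.one) = 1 := by
    intro a ha
    have : a.val < p := by simpa [Fin.lt_def] using ha
    rw [if_neg (by omega), S.rank_one]
  have h2 : ∀ a ∈ Finset.Ioi (⟨p, by omega⟩ : Fin (S.rank f)),
      S.rank (if a.val = p then w else S.one) = 1 := by
    intro a ha
    have : p < a.val := by simpa [Fin.lt_def] using ha
    rw [if_neg (by omega), S.rank_one]
  rw [Finset.sum_congr rfl h1, Finset.sum_congr rfl h2]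
  simp [hf]

/-- Filling the hole left at position `i` of a composite. -/
theorem plug_comp (S : Preclone.{u}) (f : S.Elem) (g : Fin (S.rank f) → S.Elem)
    (i : Fin (S.rank f)) (hi : g i = S.one) (p : ℕ)
    (hp : p = ∑ a ∈ Finset.Iio i, S.rank (g a)) (w : S.Elem) :
    S.plug (S.comp f g) p w = S.comp f (fun a => if a = i then w else g a) := by
  unfold plug
  rw [S.comp_assoc]
  congr 1
  funext a
  have key : ∀ j : Fin (S.rank (g a)),
      (((finSigmaFinEquiv ⟨a, j⟩ : Fin (∑ i, S.rank (g i))).val = p) ↔ a = i) := by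
    intro j
    have hr : S.rank (g i) = 1 := by rw [hi, S.rank_one]
    have h0 := finSigma_val (fun a => S.rank (g a)) i ⟨0, by omega⟩
    simp only [add_zero] at h0
    rw [hp, ← h0]
    constructor
    · intro h
      exact congrArg Sigma.fst (finSigmaFinEquiv.injective (Fin.ext h))
    · rintro rfl
      congr 3
      exact Fin.ext (by have := j.2; simp; omega)
  by_cases h : a = i
  · subst h
    rw [if_pos rfl]
    conv_rhs => rw [← S.one_comp w]
    refine S.comp_congr hi fun j j' _ => ?_
    exact if_pos ((key j).2 rfl)
  · rw [if_neg h]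
    conv_rhs => rw [← S.comp_one (g a)]
    congr 1
    funext j
    exact if_neg (fun h' => h ((key j).1 h'))

theorem off_mono {n : ℕ} (m : Fin n → ℕ) {i i' : Fin n} (h : i < i') :
    ∑ a ∈ Finset.Iio i, m a + m i ≤ ∑ a ∈ Finset.Iio i', m a := by
  rw [add_comm, ← Finset.sum_insert (by simp)]
  refine Finset.sum_le_sum_of_subset fun a ha => ?_
  simp only [Finset.mem_insert, Finset.mem_Iio] at ha ⊢
  rcases ha with rfl | ha
  · exact h
  · exact ha.trans h

theorem finSigma_lt {n : ℕ} (m : Fin n → ℕ) (i i' : Fin n) (j : Fin (m i)) (j' : Fin (m i')) :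
    (finSigmaFinEquiv ⟨i', j'⟩ : Fin (∑ i, m i)) < finSigmaFinEquiv ⟨i, j⟩ ↔
      i' < i ∨ (i' = i ∧ j'.val < j.val) := by
  rw [Fin.lt_def, finSigma_val, finSigma_val]
  rcases lt_trichotomy i' i with h | h | h
  · have := off_mono m h
    simp only [h, true_or, iff_true]
    omega
  · subst h
    simp
  · have := off_mono m h
    simp only [h.not_gt, h.ne', false_and, or_self, iff_false]
    omega

theorem sum_Iio_finSigma {n : ℕ} (m : Fin n → ℕ) (f : Fin (∑ i, m i) → ℕ) (i : Fin n)
    (j : Fin (m i)) :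
    ∑ p ∈ Finset.Iio (finSigmaFinEquiv ⟨i, j⟩), f p =
      ∑ a ∈ Finset.Iio i, ∑ b, f (finSigmaFinEquiv ⟨a, b⟩) +
        ∑ b ∈ Finset.Iio j, f (finSigmaFinEquiv ⟨i, b⟩) := by
  have e : ∀ (N : ℕ) (q : Fin N) (g : Fin N → ℕ),
      ∑ p ∈ Finset.Iio q, g p = ∑ p, if p < q then g p else 0 := by
    intro N q g
    rw [← Finset.sum_filter]
    congr 1
    ext; simp
  rw [e, ← sum_sigma m, e, e, sum_split (fun a => ∑ b, _) i, sum_split (fun a => ite _ _ _) i]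
  simp only [finSigma_lt, lt_irrefl, if_false, add_zero]
  have h1 : ∀ a ∈ Finset.Ioi i, (∑ b : Fin (m a), if a < i ∨ a = i ∧ b.val < j.val then
      f (finSigmaFinEquiv ⟨a, b⟩) else 0) = 0 := by
    intro a ha
    have ha : i < a := by simpa using ha
    simp [ha.not_gt, ha.ne']
  have h2 : ∀ a ∈ Finset.Ioi i, (if a < i then ∑ b, f (finSigmaFinEquiv ⟨a, b⟩) else 0) = 0 := by
    intro a ha
    have ha : i < a := by simpa using ha
    simp [ha.not_gt]
  rw [Finset.sum_eq_zero h1, Finset.sum_eq_zero h2, add_zero, add_zero]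
  congr 1
  · refine Finset.sum_congr rfl fun a ha => ?_
    have ha : a < i := by simpa using ha
    simp [ha]
  · simp

theorem plug_plug (S : Preclone.{u}) (f X w : S.Elem) (p q p' : ℕ) (hf : p < S.rank f)
    (hX : q < S.rank X) (hp : p' = p + q) :
    S.plug (S.plug f p X) p' w = S.plug f p (S.plug X q w) := by
  have hoff : ∀ a : Fin (S.rank f), a.val ≤ p → ∑ b ∈ Finset.Iio a,
      S.rank (if b.val = p then X else S.one) = a.val := by
    intro a ha
    rw [Finset.sum_congr rfl (g := fun _ => 1)]
    · simp
    · intro b hb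
      have : b.val < a.val := by simpa using hb
      rw [if_neg (by omega), S.rank_one]
  conv_lhs => unfold plug
  rw [S.comp_assoc]
  conv_rhs => unfold plug
  congr 1
  funext a
  by_cases h : a.val = p
  · conv_rhs => rw [if_pos h]
    refine S.comp_congr (if_pos h) fun j j' hj => ?_
    have := finSigma_val (fun i : Fin (S.rank f) => S.rank (if i.val = p then X else S.one)) a j
    rw [hoff a h.le] at this
    simp only [Fin.val_cast, this]
    have : a.val + j.val = p' ↔ j'.val = q := by omega
    simp only [this]
  · conv_rhs => rw [if_neg h, ← S.comp_one S.one]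
    refine S.comp_congr (if_neg h) fun j j' hj => ?_
    have h1 := finSigma_val (fun i : Fin (S.rank f) => S.rank (if i.val = p then X else S.one)) a j
    simp only [Fin.val_cast]
    refine if_neg ?_
    rw [h1]
    have hj1 : j.val = 0 := by
      have h2 := j'.2
      have h3 := S.rank_one
      omega
    rcases lt_or_gt_of_ne h with h' | h'
    · rw [hoff a h'.le]
      omega
    · have h2 := off_mono (fun i : Fin (S.rank f) => S.rank (if i.val = p then X else S.one))
        (i := ⟨p, hf⟩) (i' := a) h'
      rw [hoff ⟨p, hf⟩ le_rfl] at h2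
      simp only [if_true] at h2
      omega

theorem plug_act (S : Preclone.{u}) {n : ℕ} (f : S.Of n) (g : Fin n → S.Elem)
    (i : Fin n) (hi : g i = S.one) (p : ℕ)
    (hp : p = ∑ a ∈ Finset.Iio i, S.rank (g a)) (w : S.Elem) :
    S.plug (S.act f g) p w = S.act f (fun a => if a = i then w else g a) := by
  obtain ⟨f, rfl⟩ := f
  exact S.plug_comp f g i hi p hp w

theorem act_act (S : Preclone.{u}) {n : ℕ} (f : S.Of n) (g : Fin n → S.Elem) {m : ℕ}
    (h : S.rank (S.act f g) = m) {r : Fin n → ℕ} (hr : ∀ i, S.rank (g i) = r i)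
    (hm : ∑ i, r i = m) (k : Fin m → S.Elem) :
    S.act ⟨S.act f g, h⟩ k = S.act f (fun i => S.act (n := r i) ⟨g i, hr i⟩ (fun j =>
      k (Fin.cast hm (finSigmaFinEquiv ⟨i, j⟩)))) := by
  obtain ⟨f, rfl⟩ := f
  obtain rfl : (fun i => S.rank (g i)) = r := funext hr
  subst hm
  exact S.comp_assoc f g _

end Preclone

/-- The set `I_{k,n}` of `n`-ary contexts `(u, k₁, v, k₂)` in `T_k`. -/
@[ext]
structure Context (T : Preclone.{u}) (k n : ℕ) where
  u : T.Elem
  k₁ : ℕ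
  v : Fin n → T.Elem
  k₂ : ℕ
  rank_u : T.rank u = k₁ + 1 + k₂
  rank_v : k₁ + ∑ i, T.rank (v i) + k₂ = k

namespace Context

variable {T : Preclone.{u}} {k n : ℕ}

/-- The `i`-th of the consecutive blocks of `v`, of lengths `m 0, m 1, …`. -/
def block {m : Fin n → ℕ} (C : Context T k (∑ i, m i)) (i : Fin n) : Fin (m i) → T.Elem :=
  fun j => C.v (finSigmaFinEquiv ⟨i, j⟩)

/-- `g_i · v̄_i`, where `v̄_i` is the `i`-th block of `v`. -/
def gv {m : Fin n → ℕ} (g : ∀ i, T.Of (m i)) (C : Context T k (∑ i, m i)) (i : Fin n) : T.Elem :=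
  T.act (g i) (C.block i)

theorem rank_gv {m : Fin n → ℕ} (g : ∀ i, T.Of (m i)) (C : Context T k (∑ i, m i)) (i : Fin n) :
    T.rank (C.gv g i) = ∑ j, T.rank (C.block i j) :=
  T.rank_act _ _

theorem sum_rank_gv {m : Fin n → ℕ} (g : ∀ i, T.Of (m i)) (C : Context T k (∑ i, m i)) :
    ∑ i, T.rank (C.gv g i) = ∑ p, T.rank (C.v p) := by
  simp only [rank_gv]
  exact Preclone.sum_sigma m (fun p => T.rank (C.v p))

/-- The context `(u, k₁, g · v, k₂)`. -/
def outer {m : Fin n → ℕ} (g : ∀ i, T.Of (m i)) (C : Context T k (∑ i, m i)) : Context T k n where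
  u := C.u
  k₁ := C.k₁
  v := C.gv g
  k₂ := C.k₂
  rank_u := C.rank_u
  rank_v := by rw [sum_rank_gv]; exact C.rank_v

/-- `f · (g_0 · v̄_0 ⊕ ⋯ ⊕ 1 ⊕ ⋯ ⊕ g_{n-1} · v̄_{n-1})`, with `1` in position `i`. -/
def punctured (f : T.Of n) {m : Fin n → ℕ} (g : ∀ i, T.Of (m i)) (C : Context T k (∑ i, m i))
    (i : Fin n) : T.Elem :=
  T.act f (fun j => if j = i then T.one else C.gv g j)

theorem rank_punctured (f : T.Of n) {m : Fin n → ℕ} (g : ∀ i, T.Of (m i))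
    (C : Context T k (∑ i, m i)) (i : Fin n) :
    T.rank (C.punctured f g i) = ∑ j ∈ Finset.Iio i, T.rank (C.gv g j) + 1 +
      ∑ j ∈ Finset.Ioi i, T.rank (C.gv g j) := by
  unfold punctured
  rw [T.rank_act, Preclone.sum_split _ i]
  have h1 : ∀ j ∈ Finset.Iio i, T.rank (if j = i then T.one else C.gv g j) =
      T.rank (C.gv g j) := by
    intro j hj
    rw [if_neg (by simpa using (Finset.mem_Iio.1 hj).ne)]
  have h2 : ∀ j ∈ Finset.Ioi i, T.rank (if j = i then T.one else C.gv g j) =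
      T.rank (C.gv g j) := by
    intro j hj
    rw [if_neg (by simpa using (Finset.mem_Ioi.1 hj).ne')]
  rw [Finset.sum_congr rfl h1, Finset.sum_congr rfl h2, if_pos rfl, T.rank_one]

/-- The context `C_i = (c_i, p₁, v̄_i, p₂)` of the `i`-th factor in `f · (g_0 ⊕ ⋯ ⊕ g_{n-1})`, where
`c_i = u · (𝐤₁ ⊕ f · (g_0 · v̄_0 ⊕ ⋯ ⊕ 1 ⊕ ⋯ ⊕ g_{n-1} · v̄_{n-1}) ⊕ 𝐤₂)`. -/
def inner (f : T.Of n) {m : Fin n → ℕ} (g : ∀ i, T.Of (m i)) (C : Context T k (∑ i, m i))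
    (i : Fin n) : Context T k (m i) where
  u := T.plug C.u C.k₁ (C.punctured f g i)
  k₁ := C.k₁ + ∑ j ∈ Finset.Iio i, T.rank (C.gv g j)
  v := C.block i
  k₂ := ∑ j ∈ Finset.Ioi i, T.rank (C.gv g j) + C.k₂
  rank_u := by
    rw [T.rank_plug _ _ _ C.rank_u, rank_punctured]
    omega
  rank_v := by
    have h := C.rank_v
    rw [← sum_rank_gv g C] at h
    have h' := Preclone.sum_split (fun i => T.rank (C.gv g i)) i
    have h'' := rank_gv g C i
    omega

/-- Equality of contexts whose arities are only propositionally equal. -/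
def Same {n n' : ℕ} (C : Context T k n) (C' : Context T k n') : Prop :=
  n = n' ∧ C.u = C'.u ∧ C.k₁ = C'.k₁ ∧ (∀ i i', i.val = i'.val → C.v i = C'.v i') ∧ C.k₂ = C'.k₂

theorem Same.elim {n : ℕ} {C C' : Context T k n} (h : C.Same C') : C = C' :=
  Context.ext h.2.1 h.2.2.1 (funext fun i => h.2.2.2.1 i i rfl) h.2.2.2.2

/-- `k₂` is determined by the other components. -/
theorem same_of {n n' : ℕ} {C : Context T k n} {C' : Context T k n'} (hn : n = n')
    (hu : C.u = C'.u) (h₁ : C.k₁ = C'.k₁) (hv : ∀ i i', i.val = i'.val → C.v i = C'.v i') :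
    C.Same C' := by
  refine ⟨hn, hu, h₁, hv, ?_⟩
  have h := C.rank_u
  have h' := C'.rank_u
  rw [hu] at h
  omega

section Assoc

variable {m : Fin n → ℕ} {l : Fin (∑ i, m i) → ℕ} (f : T.Of n) (g : ∀ i, T.Of (m i))
  (h : ∀ p, T.Of (l p))

/-- `g_i · h̄_i`. -/
def mul (i : Fin n) : T.Of (∑ j, l (finSigmaFinEquiv ⟨i, j⟩)) :=
  ⟨T.act (g i) (fun j => (h (finSigmaFinEquiv ⟨i, j⟩)).1), by
    rw [T.rank_act]; exact Finset.sum_congr rfl fun j _ => (h _).2⟩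

variable {C : Context T k (∑ p, l p)}
  {C' : Context T k (∑ i, ∑ j, l (finSigmaFinEquiv ⟨i, j⟩))}

theorem block_block (hC : C.Same C') (i : Fin n) (j : Fin (m i)) (q q' : Fin (l (finSigmaFinEquiv ⟨i, j⟩)))
    (hq : q.val = q'.val) :
    C.block (finSigmaFinEquiv ⟨i, j⟩) q =
      C'.block (m := fun i => ∑ j, l (finSigmaFinEquiv ⟨i, j⟩)) i (finSigmaFinEquiv ⟨j, q'⟩) := by
  refine hC.2.2.2.1 _ _ ?_
  rw [Preclone.finSigma_val, Preclone.finSigma_val, Preclone.finSigma_val,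
    Preclone.sum_Iio_finSigma, hq, add_assoc]

theorem gv_gv (hC : C.Same C') (i : Fin n) (j : Fin (m i)) (f : T.Of (l (finSigmaFinEquiv ⟨i, j⟩))) :
    T.act f (C.block (finSigmaFinEquiv ⟨i, j⟩)) = T.act f (fun q =>
      C'.block (m := fun i => ∑ j, l (finSigmaFinEquiv ⟨i, j⟩)) i (finSigmaFinEquiv ⟨j, q⟩)) :=
  T.act_congr rfl fun q q' hq => block_block hC i j q q' hq

theorem gv_mul (hC : C.Same C') (i : Fin n) : C'.gv (mul g h) i = (C.outer h).gv g i := by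
  unfold gv mul
  rw [T.act_act (g i) _ _ (r := fun j => l (finSigmaFinEquiv ⟨i, j⟩)) (fun j => (h _).2) rfl]
  refine T.act_congr rfl fun j j' hj => ?_
  obtain rfl := Fin.ext hj
  exact (gv_gv hC i j _).symm

theorem same_outer (hC : C.Same C') : ((C.outer h).outer g).Same (C'.outer (mul g h)) := by
  refine same_of rfl hC.2.1 hC.2.2.1 fun i i' hi => ?_
  obtain rfl := Fin.ext hi
  exact (gv_mul g h hC i).symm

theorem same_inner (hC : C.Same C') (i : Fin n) : ((C.outer h).inner f g i).Same
    ((C'.inner f (mul g h) i).outer (fun j => h (finSigmaFinEquiv ⟨i, j⟩))) := by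
  refine same_of rfl ?_ ?_ fun j j' hj => ?_
  · change T.plug C.u C.k₁ _ = T.plug C'.u C'.k₁ _
    rw [hC.2.1, hC.2.2.1]
    congr 1
    unfold punctured
    simp only [gv_mul g h hC]
  · change C.k₁ + _ = C'.k₁ + _
    rw [hC.2.2.1]
    simp only [gv_mul g h hC]
  · obtain rfl := Fin.ext hj
    exact gv_gv hC i j _

theorem same_inner_inner (hC : C.Same C') (fg : T.Of (∑ i, m i)) (hfg : fg.1 = T.act f (fun i => (g i).1))
    (i : Fin n) (j : Fin (m i)) :
    (C.inner fg h (finSigmaFinEquiv ⟨i, j⟩)).Same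
      ((C'.inner f (mul g h) i).inner (g i) (fun j => h (finSigmaFinEquiv ⟨i, j⟩)) j) := by
  have hgv : ∀ i j, C.gv h (finSigmaFinEquiv ⟨i, j⟩) =
      (C'.inner f (mul g h) i).gv (fun j => h (finSigmaFinEquiv ⟨i, j⟩)) j :=
    fun i j => gv_gv hC i j _
  have hrank : ∀ i, T.rank (C'.gv (mul g h) i) =
      ∑ j, T.rank (C.gv h (finSigmaFinEquiv ⟨i, j⟩)) := by
    intro i
    rw [gv_mul g h hC, rank_gv]
    rfl
  refine same_of rfl ?_ ?_ fun q q' hq => block_block hC i j q q' hq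
  · change T.plug C.u C.k₁ _ = T.plug (T.plug C'.u C'.k₁ _) (C'.k₁ + _) _
    rw [T.plug_plug C'.u _ _ C'.k₁ _ _ (by have := C'.rank_u; omega) ?_ rfl, hC.2.1, hC.2.2.1]
    · congr 1
      conv_rhs => unfold punctured
      rw [T.plug_act f _ i (if_pos rfl)]
      · unfold punctured
        obtain ⟨fg, hfg'⟩ := fg
        obtain rfl : fg = _ := hfg
        rw [T.act_act f _ _ (r := m) (fun i => (g i).2) rfl]
        refine T.act_congr rfl fun a a' ha => ?_
        obtain rfl := Fin.ext ha
        by_cases hai : a = i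
        · subst hai
          rw [if_pos rfl]
          refine T.act_congr rfl fun b b' hb => ?_
          obtain rfl := Fin.ext hb
          simp only [Fin.cast_eq_self, EmbeddingLike.apply_eq_iff_eq, Sigma.mk.injEq, heq_eq_eq,
            true_and, hgv]
        · rw [if_neg hai, if_neg hai, gv_mul g h hC]
          refine T.act_congr rfl fun b b' hb => ?_
          obtain rfl := Fin.ext hb
          simp only [Fin.cast_eq_self, EmbeddingLike.apply_eq_iff_eq, Sigma.mk.injEq, hai,
            false_and, if_false]
          rfl
      · refine Finset.sum_congr rfl fun a ha => ?_
        rw [if_neg (Finset.mem_Iio.1 ha).ne]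
    · rw [rank_punctured]
      omega
  · change C.k₁ + _ = C'.k₁ + _ + _
    rw [hC.2.2.1, Preclone.sum_Iio_finSigma]
    simp only [hrank, hgv, add_assoc]

end Assoc

/-- Contexts in the unit laws. -/
theorem same_outer_unit (g : T.Of n) (C : Context T k (∑ _i : Fin 1, n)) (C' : Context T k n)
    (hC : C.Same C') (i : Fin 1) : (C.inner ⟨T.one, T.rank_one⟩ (fun _ => g) i).Same C' := by
  obtain rfl : i = 0 := Subsingleton.elim _ _
  refine same_of rfl ?_ ?_ fun j j' hj => hC.2.2.2.1 _ _ ?_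
  · rw [← hC.2.1]
    change T.plug C.u C.k₁ _ = C.u
    unfold punctured Preclone.plug
    have h1 : T.act ⟨T.one, T.rank_one⟩ (fun j : Fin 1 => if j = 0 then T.one else
        C.gv (fun _ => g) j) = T.one := by
      conv_rhs => rw [← T.one_comp T.one]
      refine T.comp_congr rfl fun a a' _ => if_pos (Subsingleton.elim _ _)
    rw [h1]
    simp only [ite_self]
    exact T.comp_one _
  · rw [← hC.2.2.1]
    change C.k₁ + _ = _
    simp
  · rw [Preclone.finSigma_val]
    simpa using hj

theorem same_outer_one (C : Context T k (∑ _i : Fin n, 1)) (C' : Context T k n)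
    (hC : C.Same C') : (C.outer (fun _ => ⟨T.one, T.rank_one⟩)).Same C' := by
  refine same_of rfl hC.2.1 hC.2.2.1 fun i i' hi => ?_
  change T.act ⟨T.one, T.rank_one⟩ _ = _
  conv_rhs => rw [← T.one_comp (C'.v i')]
  refine T.comp_congr rfl fun a a' _ => hC.2.2.2.1 _ _ ?_
  rw [Preclone.finSigma_val]
  simp [hi]

end Context

/-! ### The block product -/

/-- An element of `S □_k T`: its rank `n` and a pair in `S_n ^ {I_{k,n}} × T_n`. -/
structure BlockElem (S : Preclone.{u}) (T : Preclone.{v}) (k : ℕ) where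
  rank : ℕ
  F : Context T k rank → S.Of rank
  t : T.Of rank

namespace BlockElem

variable {S : Preclone.{u}} {T : Preclone.{v}} {k : ℕ}

theorem ext' {x y : BlockElem S T k} (hr : x.rank = y.rank) (ht : x.t.1 = y.t.1)
    (hF : ∀ C C', Context.Same C C' → (x.F C).1 = (y.F C').1) : x = y := by
  obtain ⟨n, F, t⟩ := x
  obtain ⟨n', F', t'⟩ := y
  dsimp only at hr ht hF
  subst hr
  obtain rfl : t = t' := Subtype.ext ht
  obtain rfl : F = F' := funext fun C => Subtype.ext (hF C C ⟨rfl, rfl, rfl, fun i i' h => by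
    rw [Fin.ext h], rfl⟩)
  rfl

theorem F_congr {x y : BlockElem S T k} (h : x = y) {C : Context T k x.rank}
    {C' : Context T k y.rank} (hC : C.Same C') : (x.F C).1 = (y.F C').1 := by
  subst h
  rw [hC.elim]

/-- The unit `(F_𝟏, 𝟏)`. -/
def one : BlockElem S T k := ⟨1, fun _ => ⟨S.one, S.rank_one⟩, ⟨T.one, T.rank_one⟩⟩

/-- The composition `(F, f) · ((G_0, g_0) ⊕ ⋯ ⊕ (G_{n-1}, g_{n-1})) = (Q, f · g)`, where
`Q(C) = F(u, k₁, g · v, k₂) · (G_0(C_0) ⊕ ⋯ ⊕ G_{n-1}(C_{n-1}))`. -/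
def comp (x : BlockElem S T k) (y : Fin x.rank → BlockElem S T k) : BlockElem S T k where
  rank := ∑ i, (y i).rank
  F C := ⟨S.act (x.F (C.outer fun i => (y i).t))
      (fun i => ((y i).F (C.inner x.t (fun i => (y i).t) i)).1), by
    rw [S.rank_act]; exact Finset.sum_congr rfl fun i _ => ((y i).F _).2⟩
  t := ⟨T.act x.t (fun i => (y i).t.1), by
    rw [T.rank_act]; exact Finset.sum_congr rfl fun i _ => (y i).t.2⟩

theorem one_comp (x : BlockElem S T k) : comp one (fun _ => x) = x := by
  refine ext' (by change ∑ _i : Fin 1, x.rank = x.rank; simp) (T.one_comp x.t.1) fun C C' hC => ?_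
  conv_rhs => rw [← S.one_comp (x.F C').1]
  refine S.comp_congr rfl fun i i' _ => ?_
  exact F_congr rfl (Context.same_outer_unit x.t C C' hC _)

theorem comp_one (x : BlockElem S T k) : comp x (fun _ => one) = x := by
  refine ext' (by simp [comp, one]) ?_ fun C C' hC => ?_
  · exact T.comp_one x.t.1
  · conv_rhs => rw [← S.comp_one (x.F C').1]
    refine S.comp_congr (F_congr rfl (Context.same_outer_one C C' hC)) fun i i' _ => rfl

theorem comp_assoc (x : BlockElem S T k) (y : Fin x.rank → BlockElem S T k)
    (z : Fin (∑ i, (y i).rank) → BlockElem S T k) :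
    comp (comp x y) z = comp x (fun i => comp (y i) (fun j => z (finSigmaFinEquiv ⟨i, j⟩))) := by
  refine ext' ?_ ?_ fun C C' hC => ?_
  · exact (Preclone.sum_sigma _ (fun p => (z p).rank)).symm
  · change T.act (comp x y).t (fun p => (z p).t.1) = _
    change _ = T.act x.t (fun i => (comp (y i) (fun j => z (finSigmaFinEquiv ⟨i, j⟩))).t.1)
    exact T.act_act x.t _ _ (r := fun i => (y i).rank) (fun i => (y i).t.2) rfl _
  · change S.act ((comp x y).F (C.outer fun p => (z p).t))
      (fun p => ((z p).F (C.inner (comp x y).t (fun p => (z p).t) p)).1) = _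
    change S.act ⟨S.act (x.F ((C.outer fun p => (z p).t).outer fun i => (y i).t))
      (fun i => ((y i).F ((C.outer fun p => (z p).t).inner x.t (fun i => (y i).t) i)).1), _⟩ _ = _
    refine (S.act_act (x.F ((C.outer fun p => (z p).t).outer fun i => (y i).t))
      (fun i => ((y i).F ((C.outer fun p => (z p).t).inner x.t (fun i => (y i).t) i)).1) _
      (r := fun i => (y i).rank) (fun i => ((y i).F _).2) rfl _).trans ?_
    change _ = S.act (x.F (C'.outer (Context.mul (fun i => (y i).t) (fun p => (z p).t))))
      (fun i => ((comp (y i) (fun j => z (finSigmaFinEquiv ⟨i, j⟩))).F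
        (C'.inner x.t (Context.mul (fun i => (y i).t) (fun p => (z p).t)) i)).1)
    refine S.act_congr (F_congr (x := x) rfl
      (Context.same_outer (fun i => (y i).t) (fun p => (z p).t) hC)) ?_
    intro i i' hi
    obtain rfl := Fin.ext hi
    change _ = S.act ((y i).F ((C'.inner x.t (Context.mul (fun i => (y i).t)
        (fun p => (z p).t)) i).outer fun j => (z (finSigmaFinEquiv ⟨i, j⟩)).t))
      (fun j => ((z (finSigmaFinEquiv ⟨i, j⟩)).F ((C'.inner x.t (Context.mul (fun i => (y i).t)
        (fun p => (z p).t)) i).inner (y i).t (fun j => (z (finSigmaFinEquiv ⟨i, j⟩)).t) j)).1)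
    refine S.act_congr (F_congr (x := y i) rfl
      (Context.same_inner x.t (fun i => (y i).t) (fun p => (z p).t) hC i)) ?_
    intro j j' hj
    obtain rfl := Fin.ext hj
    exact F_congr (x := z (finSigmaFinEquiv ⟨i, j⟩)) rfl
      (Context.same_inner_inner x.t (fun i => (y i).t) (fun p => (z p).t) hC (comp x y).t rfl i j)

end BlockElem

/-- The block product `S □_k T` of preclones. -/
def blockProduct (S : Preclone.{u}) (T : Preclone.{v}) (k : ℕ) : Preclone.{max u v} where
  Elem := BlockElem S T k
  rank := BlockElem.rank
  one := BlockElem.one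
  comp := BlockElem.comp
  rank_one := rfl
  rank_comp _ _ := rfl
  one_comp := BlockElem.one_comp
  comp_one := BlockElem.comp_one
  comp_assoc := BlockElem.comp_assoc

/-! ### Preclone-generator pairs -/

/-- A `pg`-pair `(S, A)`: a preclone `S` with a set `A` of generators. -/
structure PGPair extends Preclone.{u} where
  gens : Set Elem
  generated : ∀ s, toPreclone.Generated gens s

namespace PGPair

/-- `(S, A)` is finitary when each `S_n` is finite and `A` is finite. -/
def Finitary (X : PGPair.{u}) : Prop :=
  (∀ n, {s : X.Elem | X.rank s = n}.Finite) ∧ X.gens.Finite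

/-- The sub-preclone of `S` generated by `A`, with the set of generators `A`. -/
def generatedBy (S : Preclone.{u}) (A : Set S.Elem) : PGPair.{u} where
  toPreclone := S.closure A
  gens := {s | s.1 ∈ A}
  generated := by
    rintro ⟨s, hs⟩
    induction hs with
    | one => exact .one
    | mem s hs => exact .mem _ hs
    | comp f g hf hg ihf ihg =>
      exact .comp (S := S.closure A) ⟨f, hf⟩ (fun i => ⟨g i, hg i⟩) ihf ihg

/-- The block product `(S, A) □_k (T, B)`: it is generated by the pairs `(F, g)` with `g ∈ B` and all
values of `F` in `A`. -/
def blockProduct (X : PGPair.{u}) (Y : PGPair.{v}) (k : ℕ) : PGPair.{max u v} :=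
  generatedBy (TreeLogic.blockProduct X.toPreclone Y.toPreclone k)
    {x : BlockElem X.toPreclone Y.toPreclone k | x.t.1 ∈ Y.gens ∧ ∀ C, (x.F C).1 ∈ X.gens}

/-- A morphism of `pg`-pairs. -/
structure Hom (X : PGPair.{u}) (Y : PGPair.{v}) extends
    Preclone.Hom X.toPreclone Y.toPreclone where
  map_gens : ∀ s ∈ X.gens, toFun s ∈ Y.gens

/-- The morphism `φ` recognizes `L ⊆ X_k`. -/
def Hom.Recognizes {X : PGPair.{u}} {Y : PGPair.{v}} (φ : Hom X Y) (k : ℕ) (L : Set X.Elem) :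
    Prop :=
  ∃ P : Set Y.Elem, (∀ p ∈ P, Y.rank p = k) ∧ L = φ.toFun ⁻¹' P

/-- The `pg`-pair `Y` recognizes `L ⊆ X_k`. -/
def Recognizes {X : PGPair.{u}} (Y : PGPair.{v}) (k : ℕ) (L : Set X.Elem) : Prop :=
  ∃ φ : Hom X Y, φ.Recognizes k L

end PGPair

/-! ### Trees -/

/-- Trees over a ranked alphabet `Sg` (`Sg n` is the set of letters of rank `n`).  The frontier of a
tree contains each variable `v_1, …, v_n` exactly once and in that order, so a leaf labelled by a
variable is just `var`: the index of the variable is its position among the `var` leaves, counted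
from the left. -/
inductive RTree (Sg : ℕ → Type) : Type
  | var : RTree Sg
  | node {n : ℕ} (a : Sg n) (ts : Fin n → RTree Sg) : RTree Sg

namespace RTree

variable {Sg Δ : ℕ → Type}

/-- The number of variables. -/
def rank : RTree Sg → ℕ
  | var => 1
  | node _ ts => ∑ i, (ts i).rank

/-- Replacing the `i`-th variable of `t` by `g i`, for every `i`. -/
def comp : (t : RTree Sg) → (Fin t.rank → RTree Sg) → RTree Sg
  | var, g => g (0 : Fin 1)
  | node a ts, g => node a fun i => (ts i).comp fun j =>
      g (finSigmaFinEquiv ⟨i, j⟩ : Fin (∑ i, (ts i).rank))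

theorem rank_comp (t : RTree Sg) (g : Fin t.rank → RTree Sg) :
    (t.comp g).rank = ∑ i, (g i).rank := by
  induction t with
  | var => exact (Fin.sum_univ_one (fun i => (g i).rank)).symm
  | node a ts ih =>
    simp only [comp, rank, ih]
    exact Preclone.sum_sigma _ (fun p => (g p).rank)

theorem comp_var (t : RTree Sg) : t.comp (fun _ => var) = t := by
  induction t with
  | var => rfl
  | node a ts ih => simp only [comp, ih]

theorem comp_congr {t t' : RTree Sg} {g : Fin t.rank → RTree Sg} {g' : Fin t'.rank → RTree Sg}
    (ht : t = t') (hg : ∀ i i', i.val = i'.val → g i = g' i') : t.comp g = t'.comp g' := by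
  subst ht
  congr 1
  funext i
  exact hg i i rfl

theorem comp_assoc (t : RTree Sg) (g : Fin t.rank → RTree Sg)
    (h : Fin (t.comp g).rank → RTree Sg) :
    (t.comp g).comp h = t.comp (fun i => (g i).comp fun j =>
      h (Fin.cast (t.rank_comp g).symm (finSigmaFinEquiv ⟨i, j⟩))) := by
  induction t with
  | var =>
    refine comp_congr (t := g (0 : Fin 1)) (t' := g (0 : Fin 1)) rfl
      fun i i' hi => congrArg h (Fin.ext ?_)
    refine Eq.trans ?_ (Preclone.finSigma_val (fun p : Fin 1 => (g p).rank) 0 i').symm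
    exact hi.trans (Nat.zero_add _).symm
  | node a ts ih =>
    simp only [comp]
    congr 1
    funext i
    rw [ih i]
    refine comp_congr rfl fun j j' hj => ?_
    obtain rfl := Fin.ext hj
    refine comp_congr rfl fun q q' hq => congrArg h (Fin.ext ?_)
    have e := Preclone.sum_Iio_finSigma (fun i => (ts i).rank) (fun p => (g p).rank) i j
    have e1 : ∀ a, ((ts a).comp fun j => g (finSigmaFinEquiv ⟨a, j⟩ : Fin (∑ i, (ts i).rank))).rank =
        ∑ b, (g (finSigmaFinEquiv ⟨a, b⟩ : Fin (∑ i, (ts i).rank))).rank :=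
      fun a => rank_comp (ts a) _
    have e2 := Preclone.finSigma_val
      (fun b => (g (finSigmaFinEquiv ⟨i, b⟩ : Fin (∑ i, (ts i).rank))).rank) j q
    refine (Preclone.finSigma_val _ i _).trans ?_
    refine Eq.trans ?_ (Preclone.finSigma_val (fun p => (g p).rank) _ q').symm
    refine Eq.trans (congrArg₂ (· + ·) (Finset.sum_congr rfl fun a _ => e1 a) e2) ?_
    refine Eq.trans ?_ (congrArg₂ (· + ·) e.symm hq)
    exact (add_assoc _ _ _).symm

/-- The free preclone `ΣM`. -/
def preclone (Sg : ℕ → Type) : Preclone.{0} where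
  Elem := RTree Sg
  rank := rank
  one := var
  comp := comp
  rank_one := rfl
  rank_comp := rank_comp
  one_comp _ := rfl
  comp_one := comp_var
  comp_assoc := comp_assoc

/-- The tree identified with the letter `a`. -/
def letter {n : ℕ} (a : Sg n) : RTree Sg := node a fun _ => var

/-- The letters, as trees. -/
def letters (Sg : ℕ → Type) : Set (RTree Sg) := {t | ∃ (n : ℕ) (a : Sg n), t = letter a}

/-- The `pg`-pair `(ΣM, Σ)`. -/
def pgPair (Sg : ℕ → Type) : PGPair.{0} where
  toPreclone := preclone Sg
  gens := letters Sg
  generated := by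
    intro t
    induction t with
    | var => exact .one
    | @node n a ts ih =>
      have hn : (letter a).rank = n := by simp [letter, rank]
      have h : (letter a).comp (fun i => ts (Fin.cast hn i)) = node a ts := by
        simp only [letter, comp]
        congr 1
        funext i
        congr 1
        refine Fin.ext ?_
        refine (Preclone.finSigma_val (fun _ : Fin n => 1) i 0).trans ?_
        simp
      rw [← h]
      exact Preclone.Generated.comp (S := preclone Sg) (A := letters Sg) (letter a) _
        (.mem _ ⟨n, a, rfl⟩) (fun i => ih _)

/-- `NV(t)`: the nodes of `t` that are not labelled by a variable. -/
inductive Node : RTree Sg → Type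
  | root {n : ℕ} (a : Sg n) (ts : Fin n → RTree Sg) : Node (node a ts)
  | child {n : ℕ} (a : Sg n) (ts : Fin n → RTree Sg) (i : Fin n) (x : Node (ts i)) :
      Node (node a ts)

namespace Node

/-- The rank of (the label of) a node. -/
def arity : {t : RTree Sg} → Node t → ℕ
  | _, @root _ n _ _ => n
  | _, child _ _ _ x => x.arity

/-- The label of a node. -/
def label : {t : RTree Sg} → (x : Node t) → Sg x.arity
  | _, root a _ => a
  | _, child _ _ _ x => x.label

/-- The subtree rooted at a node. -/
def subtree : {t : RTree Sg} → Node t → RTree Sg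
  | _, root a ts => node a ts
  | _, child _ _ _ x => x.subtree

/-- The number of variables to the left of the frontier of the subtree rooted at a node. -/
def before : {t : RTree Sg} → Node t → ℕ
  | _, root _ _ => 0
  | _, child _ ts i x => ∑ j ∈ Finset.Iio i, (ts j).rank + x.before

/-- The root of the tree. -/
inductive IsRoot : {t : RTree Sg} → Node t → Prop
  | root {n : ℕ} (a : Sg n) (ts : Fin n → RTree Sg) : IsRoot (root a ts)

/-- `Lt x y`: the node `y` is a proper descendant of `x`. -/
inductive Lt : {t : RTree Sg} → Node t → Node t → Prop
  | root {n : ℕ} (a : Sg n) (ts : Fin n → RTree Sg) (i : Fin n) (y : Node (ts i)) :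
      Lt (root a ts) (child a ts i y)
  | child {n : ℕ} (a : Sg n) (ts : Fin n → RTree Sg) (i : Fin n) (x y : Node (ts i)) :
      Lt x y → Lt (child a ts i x) (child a ts i y)

/-- `Succ i x y`: the node `y` is the `i`-th successor of `x` (counted from `0`). -/
inductive Succ : {t : RTree Sg} → ℕ → Node t → Node t → Prop
  | root {n : ℕ} (a : Sg n) (ts : Fin n → RTree Sg) (i : Fin n) (y : Node (ts i)) :
      IsRoot y → Succ i.val (root a ts) (child a ts i y)
  | child {n : ℕ} (a : Sg n) (ts : Fin n → RTree Sg) (i : Fin n) (s : ℕ) (x y : Node (ts i)) :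
      Succ s x y → Succ s (child a ts i x) (child a ts i y)

/-- `Max i j x`: the `i`-th successor of `x` is the leaf labelled by the `j`-th variable (both
counted from `0`). -/
def Max {t : RTree Sg} (i j : ℕ) (x : Node t) : Prop :=
  match x.subtree with
  | .var => False
  | @RTree.node _ n _ ts => ∃ h : i < n, ts ⟨i, h⟩ = .var ∧
      j = x.before + ∑ a ∈ Finset.Iio (⟨i, h⟩ : Fin n), (ts a).rank

/-- `Left j x`: the last variable to the left of the frontier of the subtree rooted at `x` is the
`j`-th one (counted from `0`). -/
def Left {t : RTree Sg} (j : ℕ) (x : Node t) : Prop := x.before = j + 1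

/-- `Right j x`: the first variable to the right of the frontier of the subtree rooted at `x` is the
`j`-th one (counted from `0`). -/
def Right {t : RTree Sg} (j : ℕ) (x : Node t) : Prop :=
  x.before + x.subtree.rank = j ∧ j < t.rank

end Node

/-- The tree with the same underlying structure as `t`, in which each node `x` is labelled `d x`. -/
def relabel : (t : RTree Sg) → (∀ x : Node t, Δ x.arity) → RTree Δ
  | var, _ => var
  | node a ts, d => node (d (.root a ts)) fun i => (ts i).relabel fun x => d (.child a ts i x)

end RTree

/-! ### Formulas -/

/-- Formulas of rank `k` over `Sg`, with first-order variables from `V`.  Indices of successors and of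
variable leaves are counted from `0`.  The formula `quant Δ K x φ` is `Q_K x · ⟨φ_δ⟩_{δ ∈ Δ}`; the
conditions under which it may be formed are imposed in `Formula.IsLind`. -/
inductive Formula (Sg : ℕ → Type) (V : Type) (k : ℕ) : Type 1
  | tru : Formula Sg V k
  | fls : Formula Sg V k
  | label {n : ℕ} (a : Sg n) (x : V) : Formula Sg V k
  | lt (x y : V) : Formula Sg V k
  | succ (i : ℕ) (x y : V) : Formula Sg V k
  | root (x : V) : Formula Sg V k
  | max (i : ℕ) (j : Fin k) (x : V) : Formula Sg V k
  | left (j : Fin k) (x : V) : Formula Sg V k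
  | right (j : Fin k) (x : V) : Formula Sg V k
  | not (φ : Formula Sg V k) : Formula Sg V k
  | and (φ ψ : Formula Sg V k) : Formula Sg V k
  | or (φ ψ : Formula Sg V k) : Formula Sg V k
  | quant (Δ : ℕ → Type) (K : Set (RTree Δ)) (x : V) (φ : ∀ n, Δ n → Formula Sg V k) :
      Formula Sg V k

namespace Formula

variable {Sg : ℕ → Type} {V : Type} {k : ℕ}

/-- The free variables of a formula. -/
def freeVars : Formula Sg V k → Set V
  | tru => ∅
  | fls => ∅
  | label _ x => {x}
  | lt x y => {x, y}
  | succ _ x y => {x, y}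
  | root x => {x}
  | max _ _ x => {x}
  | left _ x => {x}
  | right _ x => {x}
  | not φ => φ.freeVars
  | and φ ψ => φ.freeVars ∪ ψ.freeVars
  | or φ ψ => φ.freeVars ∪ ψ.freeVars
  | quant _ _ x φ => (⋃ n, ⋃ d, (φ n d).freeVars) \ {x}

/-- `(t, e) ⊨ φ`, where the interpretation `e` is a partial function from `V` to `NV(t)`, defined at
least on the free variables of `φ`. -/
def Sat [DecidableEq V] (t : RTree Sg) : Formula Sg V k → (V → Option t.Node) → Prop
  | tru, _ => True
  | fls, _ => False
  | @label _ _ _ n a x, e => ∃ p, e x = some p ∧ (⟨p.arity, p.label⟩ : Σ n, Sg n) = ⟨n, a⟩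
  | lt x y, e => ∃ p q, e x = some p ∧ e y = some q ∧ p.Lt q
  | succ i x y, e => ∃ p q, e x = some p ∧ e y = some q ∧ RTree.Node.Succ i p q
  | root x, e => ∃ p, e x = some p ∧ p.IsRoot
  | max i j x, e => ∃ p, e x = some p ∧ p.Max i j
  | left j x, e => ∃ p, e x = some p ∧ p.Left j
  | right j x, e => ∃ p, e x = some p ∧ p.Right j
  | not φ, e => ¬ φ.Sat t e
  | and φ ψ, e => φ.Sat t e ∧ ψ.Sat t e
  | or φ ψ, e => φ.Sat t e ∨ ψ.Sat t e
  | quant Δ K x φ, e => ∃ d : ∀ p : t.Node, Δ p.arity,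
      (∀ p, (φ p.arity (d p)).Sat t (Function.update e x (some p))) ∧ t.relabel d ∈ K

/-- The family `⟨φ_δ⟩_{δ ∈ Δ}` is deterministic with respect to `x`. -/
def Deterministic [DecidableEq V] {Δ : ℕ → Type} (φ : ∀ n, Δ n → Formula Sg V k) (x : V) : Prop :=
  ∀ t : RTree Sg, t.rank = k → ∀ e : V → t.Node,
    ∃! d : Δ (e x).arity, (φ _ d).Sat t (fun z => some (e z))

/-- The Lindström quantification `Q_K x · ⟨φ_δ⟩_{δ ∈ Δ}` may be formed: `Δ` is a ranked alphabet with
letters of rank `n` whenever `Sg` has some, `K ⊆ ΔM_k`, and the family is deterministic with respect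
to `x`. -/
def Admissible [DecidableEq V] (Δ : ℕ → Type) (K : Set (RTree Δ)) (x : V)
    (φ : ∀ n, Δ n → Formula Sg V k) : Prop :=
  Finite (Σ n, Δ n) ∧ (∀ n, Nonempty (Sg n) → Nonempty (Δ n)) ∧ (∀ t ∈ K, t.rank = k) ∧
    Deterministic φ x

/-- `φ` is a formula of the logic `Lind`: all its quantifications are admissible. -/
def IsLind [DecidableEq V] : Formula Sg V k → Prop
  | not φ => φ.IsLind
  | and φ ψ => φ.IsLind ∧ ψ.IsLind
  | or φ ψ => φ.IsLind ∧ ψ.IsLind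
  | quant Δ K x φ => Admissible Δ K x φ ∧ ∀ n d, (φ n d).IsLind
  | _ => True

end Formula

/-- The ranked alphabet `Σ_Z`, whose letters of rank `n` are the elements of `Σ_n × 𝒫(Z)`. -/
def Ext (Sg : ℕ → Type) {V : Type} (Z : Finset V) (n : ℕ) : Type := Sg n × Set Z

/-- The `Z`-structure `str(t, e)`. -/
def str {Sg : ℕ → Type} {V : Type} {Z : Finset V} (t : RTree Sg) (e : Z → t.Node) :
    RTree (Ext Sg Z) :=
  t.relabel fun p => (p.label, {z | e z = p})

/-- The language `L_φ ⊆ Σ_Z M_k` of the `Z`-structures that satisfy `φ`, for a set `Z` containing the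
free variables of `φ`. -/
def Formula.language {Sg : ℕ → Type} {V : Type} [DecidableEq V] {k : ℕ} (φ : Formula Sg V k)
    (Z : Finset V) : Set (RTree (Ext Sg Z)) :=
  {s | ∃ t : RTree Sg, t.rank = k ∧ ∃ e : Z → t.Node, s = str t e ∧
    φ.Sat t (fun x => if h : x ∈ Z then some (e ⟨x, h⟩) else none)}

end TreeLogic

/-! Let `σ` recognize `K` and let `τ` recognize all the languages of the `φ_δ`. Membership of `t` in
the language of `Q_K y · ⟨φ_δ⟩` depends on `σ` of the characteristic tree. The label of a node `p`
in that tree is read off from `τ` of the tree in which `y` marks `p` alone. The block product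
computes exactly this. A letter `(a, A)` is sent to a pair. Its `T`-component is the `τ`-value of
the letter with `y` left unmarked. Its `S`-component, given a context, marks the letter with `y`,
fills the context with the result, and returns `σ` of the letter `δ` that this value of `T` selects.
By induction (`blockVal_F`), the `S`-component of a whole tree at a context `C` is `σ` of the tree
in which each `p` is relabelled according to the filling of `C` by the tree marked at `p`. At the
trivial context this is `σ` of the characteristic tree (`blockVal_F_trivial`).

A recognizing set must also reject the trees that are not `Y`-structures, and only the `T`-component
is available for that. For `Y = ∅` there is nothing to test. Otherwise, graft the tree below a new
root marked `y`, any further subtrees having no variables. A deterministic family accepts the result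
for some `δ` exactly when the original tree is a `Y`-structure (`exists_mem_language_iff`,
`isStructure_graft_iff`), and its `τ`-value is determined by that of the tree. Such a graft is
impossible only if all letters have rank 0. Then a tree has at most one node, and `y` can be marked
everywhere in the `T`-component. The parameter `b` covers both conventions: `False` for no mark,
`True` for all nodes marked. `quant_language_recognized` carries out the common argument for an
abstract test `D`.

Finitarity holds because contexts of fixed `k` and `n` involve only elements of rank at most `k +
1`. -/

namespace TreeLogic

/-! ### Morphisms out of the free preclone, and decorated trees. -/

namespace RTree

variable {Sg Δ : ℕ → Type}

theorem rank_letter {n : ℕ} (a : Sg n) : (letter a).rank = n := by simp [letter, rank]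

theorem letter_comp {n : ℕ} (a : Sg n) (ts : Fin n → RTree Sg) :
    (letter a).comp (fun i => ts (Fin.cast (rank_letter a) i)) = node a ts := by
  simp only [letter, comp]
  congr 1
  funext i
  congr 1
  refine Fin.ext ?_
  refine (Preclone.finSigma_val (fun _ : Fin n => 1) i 0).trans ?_
  simp

/-- The map from `ΣM` that extends an assignment of elements of `P` to the letters. -/
def lift (P : Preclone.{u}) (h : ∀ n, Sg n → P.Of n) : RTree Sg → P.Elem
  | var => P.one
  | node a ts => P.act (h _ a) fun i => (ts i).lift P h

variable (P : Preclone.{u}) (h : ∀ n, Sg n → P.Of n)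

theorem rank_lift (t : RTree Sg) : P.rank (t.lift P h) = t.rank := by
  induction t with
  | var => exact P.rank_one
  | node a ts ih => simp only [lift, rank, P.rank_act, ih]

theorem lift_comp (t : RTree Sg) (g : Fin t.rank → RTree Sg) :
    (t.comp g).lift P h =
      P.comp (t.lift P h) fun i => (g (Fin.cast (rank_lift P h t) i)).lift P h := by
  induction t with
  | var =>
    refine (P.one_comp ((g (0 : Fin 1)).lift P h)).symm.trans (P.comp_congr rfl fun i i' _ => ?_)
    exact congrArg (fun j : Fin 1 => (g j).lift P h) (Subsingleton.elim _ _)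
  | node a ts ih =>
    simp only [comp, lift, ih]
    refine Eq.trans ?_ (P.act_act (h _ a) (fun i => (ts i).lift P h) rfl
      (r := fun i => (ts i).rank) (fun i => rank_lift P h (ts i))
      (by rw [P.rank_act]; simp only [rank_lift])
      (fun i => (g (Fin.cast (rank_lift P h (node a ts)) i)).lift P h)).symm
    refine P.act_congr rfl fun i i' hi => ?_
    obtain rfl := Fin.ext hi
    exact P.comp_congr rfl fun j j' hj => by obtain rfl := Fin.ext hj; rfl

/-- The morphism of `pg`-pairs from `(ΣM, Σ)` that extends an assignment of generators to the
letters. -/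
def liftHom (P : PGPair.{u}) (h : ∀ n, Sg n → P.Of n) (hP : ∀ n a, (h n a).1 ∈ P.gens) :
    PGPair.Hom (pgPair Sg) P where
  toFun := lift P.toPreclone h
  rank_map := rank_lift P.toPreclone h
  map_one := rfl
  map_comp := lift_comp P.toPreclone h
  map_gens := by
    rintro _ ⟨n, a, rfl⟩
    have : lift P.toPreclone h (letter a) = (h n a).1 := P.comp_one _
    rw [this]
    exact hP n a

/-- The value of a morphism at a letter. -/
def letterVal {S : Preclone.{u}} (τ : Preclone.Hom (preclone Sg) S) {n : ℕ} (a : Sg n) : S.Of n :=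
  ⟨τ.toFun (letter a), (τ.rank_map _).trans (rank_letter a)⟩

/-- A node is its letter composed with its subtrees, so every morphism can be evaluated from the
leaves upwards. -/
theorem map_node {S : Preclone.{u}} (τ : Preclone.Hom (preclone Sg) S) {n : ℕ} (a : Sg n)
    (ts : Fin n → RTree Sg) :
    τ.toFun (node a ts) = S.act (letterVal τ a) fun i => τ.toFun (ts i) := by
  rw [← letter_comp a ts]
  exact τ.map_comp (letter a) fun i => ts (Fin.cast (rank_letter a) i)

theorem relabel_injective {t : RTree Sg} :
    Function.Injective (relabel (Δ := Δ) t) := by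
  induction t with
  | var => exact fun d d' _ => funext fun x => nomatch x
  | node a ts ih =>
    intro d d' hd
    simp only [relabel, node.injEq, heq_eq_eq, true_and] at hd
    funext x
    cases x with
    | root => exact hd.1
    | child _ _ i x => exact congrFun (ih i (congrFun hd.2 i)) x

theorem rank_relabel (t : RTree Sg) (d : ∀ x : t.Node, Δ x.arity) : (t.relabel d).rank = t.rank := by
  induction t with
  | var => rfl
  | node a ts ih => exact Finset.sum_congr rfl fun i _ => ih i _

/-- The tree over `Σ_Z` obtained from `t` by adding the set `d x` to the label of each node `x`. -/
def decorate {V : Type} {Z : Finset V} (t : RTree Sg) (d : t.Node → Set Z) : RTree (Ext Sg Z) :=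
  t.relabel fun x => (x.label, d x)

section Decorate

variable {V : Type} {Z : Finset V}

theorem rank_decorate (t : RTree Sg) (d : t.Node → Set Z) : (t.decorate d).rank = t.rank :=
  rank_relabel t _

theorem decorate_node {n : ℕ} (a : Sg n) (ts : Fin n → RTree Sg) (d : (node a ts).Node → Set Z) :
    (node a ts).decorate d = node (Sg := Ext Sg Z) (n := n) (a, d (.root a ts)) fun i =>
      (ts i).decorate fun x => d (.child a ts i x) :=
  rfl

/-- The tree over `Σ` underlying a tree over `Σ_Z`. -/
def erase : RTree (Ext Sg Z) → RTree Sg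
  | var => var
  | @node _ _ a ts => node a.1 fun i => (ts i).erase

theorem erase_decorate (t : RTree Sg) (d : t.Node → Set Z) : (t.decorate d).erase = t := by
  induction t with
  | var => rfl
  | node a ts ih => simp only [decorate_node, erase, ih]

/-- Decorations are arbitrary set-valued functions because subtrees of `Z`-structures are in general
not `Z`-structures, while the inductions pass to subtrees. -/
theorem exists_decorate (s : RTree (Ext Sg Z)) :
    ∃ (t : RTree Sg) (d : t.Node → Set Z), s = t.decorate d := by
  induction s with
  | var => exact ⟨var, (fun x => nomatch x), rfl⟩
  | node a ts ih =>
    choose t d h using ih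
    refine ⟨node a.1 t, fun | .root _ _ => a.2 | .child _ _ i x => d i x, ?_⟩
    rw [decorate_node]
    exact congrArg _ (funext h)

theorem decorate_injective (t : RTree Sg) : Function.Injective (decorate (Z := Z) t) := by
  intro d d' h
  funext x
  exact congrArg Prod.snd (congrFun (relabel_injective h) x)

end Decorate

end RTree

/-! ### Filling a context. -/

namespace Context

variable {T : Preclone.{u}} {k n : ℕ}

/-- `u · (𝐤₁ ⊕ w · v ⊕ 𝐤₂)`. -/
def fill (C : Context T k n) (w : T.Of n) : T.Elem := T.plug C.u C.k₁ (T.act w C.v)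

variable {m : Fin n → ℕ}

/-- Associativity: `f · (g · v) = (f · g) · v`. It is used when the marked node is the root. -/
theorem fill_outer (f : T.Of n) (g : ∀ i, T.Of (m i)) (C : Context T k (∑ i, m i))
    (w : T.Of (∑ i, m i)) (hw : w.1 = T.act f fun i => (g i).1) :
    (C.outer g).fill f = C.fill w := by
  obtain ⟨w, hr⟩ := w
  obtain rfl : w = _ := hw
  unfold fill
  rw [T.act_act f _ _ (r := m) (fun i => (g i).2) rfl]
  rfl

/-- The inner context `C_i` already contains `f` and the siblings `g_j · v̄_j`, so plugging its hole
rebuilds the composite with `w` in position `i`. It is used when the marked node lies in the `i`-th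
subtree. -/
theorem fill_inner (f : T.Of n) (g : ∀ i, T.Of (m i)) (C : Context T k (∑ i, m i)) (i : Fin n)
    (w : T.Of (m i)) (w' : T.Of (∑ i, m i))
    (hw : w'.1 = T.act f fun j => if j = i then w.1 else (g j).1) :
    (C.inner f g i).fill w = C.fill w' := by
  obtain ⟨w', hr⟩ := w'
  obtain rfl : w' = _ := hw
  unfold fill
  change T.plug (T.plug C.u C.k₁ (C.punctured f g i))
    (C.k₁ + ∑ j ∈ Finset.Iio i, T.rank (C.gv g j)) (T.act w (C.block i)) = _
  rw [T.plug_plug C.u _ _ C.k₁ _ _ (by have := C.rank_u; omega)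
    (by rw [rank_punctured]; omega) rfl]
  congr 1
  unfold punctured
  rw [T.plug_act f _ i (if_pos rfl)]
  · rw [T.act_act f _ _ (r := m) (fun j => ?_) rfl]
    · refine T.act_congr rfl fun j j' hj => ?_
      obtain rfl := Fin.ext hj
      by_cases h : j = i
      · subst h
        rw [if_pos rfl]
        exact T.act_congr (if_pos rfl).symm fun q q' hq => by obtain rfl := Fin.ext hq; rfl
      · rw [if_neg h, if_neg h]
        exact T.act_congr (if_neg h).symm fun q q' hq => by obtain rfl := Fin.ext hq; rfl
    · by_cases h : j = i
      · subst h; rw [if_pos rfl]; exact w.2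
      · rw [if_neg h]; exact (g j).2
  · refine Finset.sum_congr rfl fun a ha => ?_
    rw [if_neg (Finset.mem_Iio.1 ha).ne]

/-- The context `(𝟏, 0, 𝟏 ⊕ ⋯ ⊕ 𝟏, 0)`. -/
def trivial (T : Preclone.{u}) (h : n = k) : Context T k n where
  u := T.one
  k₁ := 0
  v _ := T.one
  k₂ := 0
  rank_u := T.rank_one
  rank_v := by simp [T.rank_one, h]

theorem fill_trivial (h : n = k) (w : T.Of n) : (trivial T h).fill w = w.1 := by
  have h1 : T.act w (fun _ => T.one) = w.1 := T.comp_one _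
  unfold fill trivial
  dsimp only
  rw [h1]
  refine Eq.trans (T.comp_congr rfl fun i i' _ => if_pos ?_) (T.one_comp w.1)
  have := i.2
  have := T.rank_one
  omega

end Context

/-! ### Marking the quantified variable, and the two components in the block product. -/

/-- The subset of `Y ∪ {y}` consisting of the elements of `A ⊆ Y`, and of `y` if `b` holds. -/
def adjoin {V : Type} [DecidableEq V] {Y : Finset V} (y : V) (A : Set Y) (b : Prop) :
    Set (insert y Y : Finset V) :=
  {z | (z.1 = y ∧ b) ∨ ∃ h : z.1 ∈ Y, ⟨z.1, h⟩ ∈ A}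

/-- The decoration `d` is that of a `Z`-structure. -/
def IsStructure {Sg : ℕ → Type} {V : Type} {Z : Finset V} {t : RTree Sg} (d : t.Node → Set Z) :
    Prop :=
  ∃ e : Z → t.Node, ∀ p, d p = {z | e z = p}

/-- The interpretation, as a partial function, given by a function on `Z`. -/
def interp {V : Type} [DecidableEq V] {Z : Finset V} {N : Type} (e : Z → N) (x : V) : Option N :=
  if h : x ∈ Z then some (e ⟨x, h⟩) else none

section Block

open RTree

theorem map_decorate_node {Sg : ℕ → Type} {T : Preclone.{u}}
    {V : Type} {Z : Finset V} (τ : Preclone.Hom (preclone (Ext Sg Z)) T) {n : ℕ}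
    (a : Sg n) (ts : Fin n → RTree Sg) (d : (node a ts).Node → Set Z) :
    τ.toFun ((node a ts).decorate d) =
      T.act (letterVal τ (Sg := Ext Sg Z) (n := n) (a, d (.root a ts))) fun i =>
        τ.toFun ((ts i).decorate fun x => d (.child a ts i x)) :=
  map_node τ _ _

variable {Sg Δ : ℕ → Type} {V : Type} [DecidableEq V] {Y : Finset V} {y : V}
  {S : Preclone.{u}} {T : Preclone.{v}} (σ : Preclone.Hom (preclone Δ) S)
  (τ : Preclone.Hom (preclone (Ext Sg (insert y Y))) T) (k : ℕ) (b : Prop)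
  (ch : ∀ n, Sg n → T.Elem → Δ n)

/-- The element of the block product assigned to a letter. -/
def blockLetter (n : ℕ) (a : Ext Sg Y n) : (blockProduct S T k).Of n :=
  ⟨{ rank := n
     -- The current letter is marked with `y` here whatever `b` is; only the surrounding
     -- `T`-components follow `b`.
     F := fun C => letterVal σ (ch n a.1
       (C.fill (letterVal τ (Sg := Ext Sg (insert y Y)) (n := n) (a.1, adjoin y a.2 True))))
     t := letterVal τ (Sg := Ext Sg (insert y Y)) (n := n) (a.1, adjoin y a.2 b) }, rfl⟩

/-- The element of the block product assigned to a decorated tree. -/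
def blockVal (t : RTree Sg) (d : t.Node → Set Y) : BlockElem S T k :=
  (t.decorate d).lift (blockProduct S T k) (blockLetter σ τ k b ch)

theorem rank_blockVal (t : RTree Sg) (d : t.Node → Set Y) :
    (blockVal σ τ k b ch t d).rank = t.rank :=
  (rank_lift (blockProduct S T k) _ _).trans (rank_decorate t d)

theorem rank_map_decorate (t : RTree Sg) (d : t.Node → Set Y)
    (d' : t.Node → Set (insert y Y : Finset V)) :
    T.rank (τ.toFun (t.decorate d')) = (blockVal σ τ k b ch t d).rank :=
  (τ.rank_map _).trans ((rank_decorate t d').trans (rank_blockVal σ τ k b ch t d).symm)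

theorem blockVal_t (t : RTree Sg) (d : t.Node → Set Y) :
    (blockVal σ τ k b ch t d).t.1 = τ.toFun (t.decorate fun q => adjoin y (d q) b) := by
  induction t with
  | var => exact τ.map_one.symm
  | @node n a ts ih =>
    refine Eq.trans ?_ (map_decorate_node τ a ts fun q => adjoin y (d q) b).symm
    change T.act (letterVal τ (Sg := Ext Sg (insert y Y)) (n := n) (a, adjoin y (d (.root a ts)) b))
      (fun i => (blockVal σ τ k b ch (ts i) fun x => d (.child a ts i x)).t.1) = _
    exact T.act_congr rfl fun i i' hi => by obtain rfl := Fin.ext hi; exact ih i _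

/-- The composition of the block product distributes contexts as the relabelling requires: the root
letter sees the outer context, and the `i`-th subtree the inner context `C_i`. The siblings and the
root enter `C_i` through their `T`-components, hence with the mark `b`, which gives the condition `q
= p ∨ b`. -/
theorem blockVal_F (t : RTree Sg) (d : t.Node → Set Y)
    (C : Context T k (blockVal σ τ k b ch t d).rank) :
    ((blockVal σ τ k b ch t d).F C).1 = σ.toFun (t.relabel fun p => ch p.arity p.label
      (C.fill ⟨τ.toFun (t.decorate fun q => adjoin y (d q) (q = p ∨ b)),
        rank_map_decorate σ τ k b ch t d _⟩)) := by
  induction t with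
  | var => exact σ.map_one.symm
  | @node n a ts ih =>
    simp only [relabel]
    rw [map_node]
    let f := blockLetter σ τ k b ch n (a, d (.root a ts))
    let g := fun i => blockVal σ τ k b ch (ts i) fun x => d (.child a ts i x)
    change Context T k (∑ i, (g i).rank) at C
    change S.act (f.1.F (C.outer fun i => (g i).t))
      (fun i => ((g i).F (C.inner f.1.t (fun i => (g i).t) i)).1) = _
    refine S.act_congr ?_ fun (i : Fin n) i' hi => ?_
    · change σ.toFun (letter (ch n a _)) = σ.toFun (letter (ch n a _))
      congr 3
      refine Context.fill_outer _ (fun i => (g i).t) C _ ?_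
      refine (map_decorate_node τ a ts _).trans (T.act_congr ?_ fun i i' hi => ?_)
      · simp
      · obtain rfl := Fin.ext hi
        refine Eq.trans ?_ (blockVal_t σ τ k b ch (ts i) _).symm
        simp
    · obtain rfl := Fin.ext hi
      refine (ih i _ _).trans ?_
      congr 2
      funext p
      change ch p.arity p.label _ = ch p.arity p.label _
      congr 1
      refine Context.fill_inner f.1.t (fun i => (g i).t) C i _ _ ?_
      refine (map_decorate_node τ a ts _).trans (T.act_congr ?_ fun j j' hj => ?_)
      · simp [f, blockLetter]
      · obtain rfl := Fin.ext hj
        by_cases h : j = i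
        · subst h
          refine Eq.trans ?_ (if_pos rfl).symm
          simp
        · refine Eq.trans ?_ ((if_neg h).trans (blockVal_t σ τ k b ch (ts j) _)).symm
          -- In a sibling subtree no node equals the marked one, so `q = p ∨ b` reduces to `b`.
          have : ∀ q, Node.child a ts j q ≠ Node.child a ts i p := fun q hq => by
            cases hq
            exact h rfl
          simp [this]

/-- The hypothesis `hb` holds if `b` is false, and also if `t` has at most one node. Under it, `y`
marks `p` alone, as the characteristic tree demands. -/
theorem blockVal_F_trivial (t : RTree Sg) (d : t.Node → Set Y)
    (h : (blockVal σ τ k b ch t d).rank = k) (hb : ∀ p q : t.Node, (q = p ∨ b) ↔ q = p) :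
    ((blockVal σ τ k b ch t d).F (.trivial T h)).1 = σ.toFun (t.relabel fun p =>
      ch p.arity p.label (τ.toFun (t.decorate fun q => adjoin y (d q) (q = p)))) := by
  rw [blockVal_F]
  congr 2
  funext p
  refine congrArg (ch p.arity p.label) ((Context.fill_trivial h _).trans ?_)
  simp only [hb]

end Block

/-! ### Satisfaction in terms of decorated trees. -/

namespace Formula

variable {Sg Δ : ℕ → Type} {V : Type} [DecidableEq V] {k : ℕ}

theorem sat_congr {t : RTree Sg} (φ : Formula Sg V k) {e e' : V → Option t.Node}
    (h : ∀ x ∈ φ.freeVars, e x = e' x) : φ.Sat t e ↔ φ.Sat t e' := by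
  induction φ generalizing e e' with
  | tru | fls => rfl
  | label | root | max | left | right => simp only [Sat, h _ rfl]
  | lt x y | succ _ x y => simp only [Sat, h x (Or.inl rfl), h y (Or.inr rfl)]
  | not φ ih => exact not_congr (ih h)
  | and φ ψ ih ih' =>
    exact and_congr (ih fun x hx => h x (Or.inl hx)) (ih' fun x hx => h x (Or.inr hx))
  | or φ ψ ih ih' =>
    exact or_congr (ih fun x hx => h x (Or.inl hx)) (ih' fun x hx => h x (Or.inr hx))
  | quant Δ K x φ ih =>
    refine exists_congr fun d => and_congr_left fun _ => forall_congr' fun p => ih _ _ ?_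
    intro z hz
    by_cases hzx : z = x
    · subst hzx; simp
    · simp only [Function.update_of_ne hzx]
      exact h z ⟨Set.mem_iUnion₂.2 ⟨_, _, hz⟩, hzx⟩

/-- A decorated tree determines both the tree (by `erase`) and the decoration (by injectivity), so
the existential over trees in `language` disappears. -/
theorem decorate_mem_language {Z : Finset V} (φ : Formula Sg V k) {t : RTree Sg}
    {d : t.Node → Set Z} :
    t.decorate d ∈ φ.language Z ↔
      t.rank = k ∧ ∃ e : Z → t.Node, (∀ p, d p = {z | e z = p}) ∧ φ.Sat t (interp e) := by
  constructor
  · rintro ⟨t', ht, e, hs, hsat⟩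
    have h : t = t' := by
      have := congrArg RTree.erase hs
      rwa [RTree.erase_decorate, show str t' e = t'.decorate fun p => {z | e z = p} from rfl,
        RTree.erase_decorate] at this
    subst h
    exact ⟨ht, e, congrFun (RTree.decorate_injective t hs), hsat⟩
  · rintro ⟨ht, e, hd, hsat⟩
    refine ⟨t, ht, e, ?_, hsat⟩
    rw [show d = fun p => {z | e z = p} from funext hd]
    rfl

variable {Y : Finset V} {y : V}

theorem decorate_adjoin_mem_language (hy : y ∉ Y) (φ : Formula Sg V k) {t : RTree Sg}
    (ht : t.rank = k) (e : Y → t.Node) (p : t.Node) :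
    (t.decorate fun q => adjoin y {z | e z = q} (q = p)) ∈ φ.language (insert y Y) ↔
      φ.Sat t (Function.update (interp e) y (some p)) := by
  rw [decorate_mem_language]
  constructor
  · rintro ⟨-, e', he', hsat⟩
    convert hsat using 1
    funext x
    have hmem : ∀ z : (insert y Y : Finset V), z ∈ adjoin y {w : Y | e w = e' z} (e' z = p) :=
      fun z => by
        rw [he']
        exact rfl
    by_cases hx : x = y
    · subst hx
      rcases hmem ⟨x, by simp⟩ with ⟨-, h⟩ | ⟨h, -⟩
      · simp [interp, h]
      · exact absurd h hy
    · rw [Function.update_of_ne hx]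
      by_cases hxY : x ∈ Y
      · rcases hmem ⟨x, by simp [hxY]⟩ with ⟨h, -⟩ | ⟨h, h'⟩
        · exact absurd h hx
        · have h' : e ⟨x, hxY⟩ = e' ⟨x, by simp [hxY]⟩ := h'
          simp [interp, hxY, h']
      · simp [interp, hxY, hx]
  · intro hsat
    refine ⟨ht, fun z => if h : z.1 ∈ Y then e ⟨z.1, h⟩ else p, fun q => ?_, ?_⟩
    · ext ⟨z, hz⟩
      rcases Finset.mem_insert.1 hz with rfl | hz
      · simp [adjoin, hy, eq_comm]
      · have : z ≠ y := fun h => hy (h ▸ hz)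
        simp [adjoin, hz, this]
    · convert hsat using 1
      funext x
      by_cases hx : x = y
      · subst hx
        simp [interp, hy]
      · rw [Function.update_of_ne hx]
        by_cases hxY : x ∈ Y <;> simp [interp, hxY, hx]

/-- The interpretation of `Y ∪ {y}` restricts to `Y`; as `y ∉ Y`, the mark `b` does not affect the
elements of `Y`. -/
theorem isStructure_of_mem_language (hy : y ∉ Y) {φ : Formula Sg V k} {t : RTree Sg}
    {d : t.Node → Set Y} {b : t.Node → Prop}
    (h : (t.decorate fun q => adjoin y (d q) (b q)) ∈ φ.language (insert y Y)) :
    IsStructure d := by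
  obtain ⟨-, e, he, -⟩ := φ.decorate_mem_language.1 h
  refine ⟨fun z => e ⟨z.1, Finset.mem_insert_of_mem z.2⟩, fun p => Set.ext fun z => ?_⟩
  have hz : z.1 ≠ y := fun h => hy (h ▸ z.2)
  have := Set.ext_iff.1 (he p) ⟨z.1, Finset.mem_insert_of_mem z.2⟩
  simpa [adjoin, hz] using this

theorem Deterministic.existsUnique {Y : Finset V} {y : V} {φ : ∀ n, Δ n → Formula Sg V k} (hφ : Deterministic φ y)
    (hfree : ∀ n δ, (φ n δ).freeVars ⊆ (insert y Y : Finset V)) {t : RTree Sg} (ht : t.rank = k)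
    (e : Y → t.Node) (p : t.Node) :
    ∃! δ : Δ p.arity, (φ _ δ).Sat t (Function.update (interp e) y (some p)) := by
  -- `Deterministic` speaks of total interpretations. The default `p` outside `Y` is harmless, since
  -- no `φ_δ` has free variables there.
  let e' : V → t.Node := Function.update (fun x => (interp e x).getD p) y p
  have h := hφ t ht e'
  rw [show e' y = p by simp [e']] at h
  refine (existsUnique_congr fun δ => ?_).2 h
  refine sat_congr _ fun x hx => ?_
  by_cases hxy : x = y
  · subst hxy; simp [e']
  · have hxY : x ∈ Y := by simpa [hxy] using hfree _ _ hx
    simp [e', hxy, interp, hxY]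

end Formula

/-! ### Finitarity of the block product. -/

section Finite

theorem Preclone.finite_of_rank_le {T : Preclone.{u}} (hT : ∀ n, {s : T.Elem | T.rank s = n}.Finite)
    (N : ℕ) : Finite {s : T.Elem // T.rank s ≤ N} := by
  refine Set.Finite.to_subtype (s := {s | T.rank s ≤ N}) ?_
  refine ((Set.finite_Iic N).biUnion fun n _ => hT n).subset fun s hs => ?_
  exact Set.mem_biUnion (show T.rank s ∈ Set.Iic N from hs) rfl

/-- Since `k₁ + k₂ ≤ k`, the rank of `u` is at most `k + 1`, and each `v_i` has rank at most `k`. -/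
theorem Context.finite {T : Preclone.{u}} (hT : ∀ n, {s : T.Elem | T.rank s = n}.Finite)
    (k n : ℕ) : Finite (Context T k n) := by
  have := Preclone.finite_of_rank_le hT (k + 1)
  let F : Context T k n →
      {s : T.Elem // T.rank s ≤ k + 1} × Fin (k + 1) × (Fin n → {s : T.Elem // T.rank s ≤ k + 1}) ×
        Fin (k + 1) := fun C =>
    (⟨C.u, by have := C.rank_u; have := C.rank_v; omega⟩, ⟨C.k₁, by have := C.rank_v; omega⟩,
      fun i => ⟨C.v i, by
        have h := Finset.single_le_sum (f := fun i => T.rank (C.v i)) (fun _ _ => Nat.zero_le _)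
          (Finset.mem_univ i)
        have := C.rank_v
        omega⟩,
      ⟨C.k₂, by have := C.rank_v; omega⟩)
  refine Finite.of_injective F fun C C' h => ?_
  simp only [F, Prod.mk.injEq, Subtype.mk.injEq, Fin.mk.injEq] at h
  exact Context.ext h.1 h.2.1 (funext fun i => congrArg Subtype.val (congrFun h.2.2.1 i)) h.2.2.2

theorem BlockElem.finite_rank {S : Preclone.{u}} {T : Preclone.{v}}
    (hS : ∀ n, {s : S.Elem | S.rank s = n}.Finite) (hT : ∀ n, {s : T.Elem | T.rank s = n}.Finite)
    (k n : ℕ) : {x : BlockElem S T k | x.rank = n}.Finite := by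
  have := Context.finite hT k n
  have : Finite (S.Of n) := (hS n).to_subtype
  have : Finite (T.Of n) := (hT n).to_subtype
  refine (Set.finite_range fun p : (Context T k n → S.Of n) × T.Of n =>
    (⟨n, p.1, p.2⟩ : BlockElem S T k)).subset ?_
  rintro ⟨_, F, t⟩ rfl
  exact ⟨(F, t), rfl⟩

theorem PGPair.Finitary.blockProduct {S : PGPair.{u}} {T : PGPair.{v}} (hS : S.Finitary)
    (hT : T.Finitary) (k : ℕ) : (S.blockProduct T k).Finitary := by
  have hfin := BlockElem.finite_rank hS.1 hT.1 k
  refine ⟨fun n => ((hfin n).preimage Subtype.val_injective.injOn), ?_⟩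
  -- A generator has the rank of its `T`-component, which is one of the finitely many generators of
  -- `T`; so only finitely many sorts contain generators.
  refine Set.Finite.subset (s := Subtype.val ⁻¹' ⋃ n ∈ T.rank '' T.gens,
    {x : BlockElem S.toPreclone T.toPreclone k | x.rank = n}) ?_ ?_
  · exact ((hT.2.image _).biUnion fun n _ => hfin n).preimage Subtype.val_injective.injOn
  · intro x hx
    exact Set.mem_biUnion (Set.mem_image_of_mem _ hx.1) x.1.t.2.symm

end Finite

/-! ### Recognition of the quantified language, given a test for structures. -/

section Block

open RTree

variable {Sg Δ : ℕ → Type} {V : Type} [DecidableEq V] {Y : Finset V} {y : V} {k : ℕ}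
  {S : PGPair.{u}} {T : PGPair.{v}} (σ : PGPair.Hom (pgPair Δ) S)
  (τ : PGPair.Hom (pgPair (Ext Sg (insert y Y))) T) (b : Prop)
  (ch : ∀ n, Sg n → T.Elem → Δ n)

theorem blockLetter_mem (k n : ℕ) (a : Ext Sg Y n) :
    (blockLetter σ.toHom τ.toHom k b ch n a).1.t.1 ∈ T.gens ∧
      ∀ C, ((blockLetter σ.toHom τ.toHom k b ch n a).1.F C).1 ∈ S.gens :=
  ⟨τ.map_gens _ ⟨n, _, rfl⟩, fun _ => σ.map_gens _ ⟨n, _, rfl⟩⟩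

/-- The morphism to the block product that extends `blockLetter`. -/
def blockHom (k : ℕ) : PGPair.Hom (pgPair (Ext Sg Y)) (S.blockProduct T k) :=
  liftHom (S.blockProduct T k)
    (fun n a => ⟨⟨(blockLetter σ.toHom τ.toHom k b ch n a).1,
      .mem _ (blockLetter_mem σ τ b ch k n a)⟩, rfl⟩)
    fun n a => blockLetter_mem σ τ b ch k n a

theorem blockHom_decorate (t : RTree Sg) (d : t.Node → Set Y) :
    ((blockHom σ τ b ch k).toFun (t.decorate d)).1 = blockVal σ.toHom τ.toHom k b ch t d := by
  induction t with
  | var => rfl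
  | node a ts ih =>
    exact congrArg (BlockElem.comp (blockLetter σ.toHom τ.toHom k b ch _ _).1)
      (funext fun i => ih i _)

/-- The `S`-component at the trivial context decides satisfaction on `Y`-structures, and `D` decides
from the `T`-component whether the tree is a `Y`-structure. Both are needed, as the `S`-component is
meaningless on other trees. -/
theorem quant_language_recognized (hy : y ∉ Y) {φ : ∀ n, Δ n → Formula Sg V k}
    (hfree : ∀ n δ, (φ n δ).freeVars ⊆ (insert y Y : Finset V))
    {K : Set (RTree Δ)} (hadm : Formula.Admissible Δ K y φ) (hσ : σ.Recognizes k K)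
    (hτ : ∀ n δ, τ.Recognizes k ((φ n δ).language (insert y Y)))
    (hb : ∀ t : RTree Sg, t.rank = k → ∀ p q : t.Node, (q = p ∨ b) ↔ q = p)
    (D : T.Elem → Prop)
    (hD : ∀ t : RTree Sg, t.rank = k → ∀ d : t.Node → Set Y,
      D (τ.toFun (t.decorate fun q => adjoin y (d q) b)) ↔ IsStructure d) :
    (S.blockProduct T k).Recognizes (X := pgPair (Ext Sg Y)) k
      ((Formula.quant Δ K y φ).language Y) := by
  obtain ⟨P, -, hP⟩ := hσ
  have hK : ∀ s, s ∈ K ↔ σ.toFun s ∈ P := fun s => by rw [hP]; rfl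
  clear hP
  choose R _ hR using hτ
  -- `ch` picks a `δ` whose accepting set contains the value, and an arbitrary letter if there is
  -- none. The argument in `Sg n` serves only to make `Δ n` nonempty.
  obtain ⟨ch, hch⟩ : ∃ ch : ∀ n, Sg n → T.Elem → Δ n,
      ∀ n a w, (∃ δ, w ∈ R n δ) → w ∈ R n (ch n a w) := by
    have h : ∀ n (_ : Sg n) (w : T.Elem), ∃ δ : Δ n, (∃ δ, w ∈ R n δ) → w ∈ R n δ := fun n a w => by
      by_cases h : ∃ δ, w ∈ R n δ
      · exact ⟨h.choose, fun _ => h.choose_spec⟩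
      · exact ⟨(hadm.2.1 n ⟨a⟩).some, fun h' => absurd h' h⟩
    choose ch hch using h
    exact ⟨ch, hch⟩
  have key : ∀ (t : RTree Sg) (ht : t.rank = k) (d : t.Node → Set Y) (e : Y → t.Node),
      (∀ p, d p = {z | e z = p}) → ((Formula.quant Δ K y φ).Sat t (interp e) ↔
        ((blockVal σ.toHom τ.toHom k b ch t d).F
          (.trivial _ ((rank_blockVal σ.toHom τ.toHom k b ch t d).trans ht))).1 ∈ P) := by
    intro t ht d e hd
    obtain rfl : d = fun p => {z | e z = p} := funext hd
    refine Iff.trans ?_ (iff_of_eq (congrArg (· ∈ P)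
      (blockVal_F_trivial σ.toHom τ.toHom k b ch t _ _ (hb t ht)))).symm
    have hmem : ∀ (p : t.Node) (δ : Δ p.arity), τ.toFun (t.decorate fun q =>
        adjoin y {z | e z = q} (q = p)) ∈ R _ δ ↔
          (φ _ δ).Sat t (Function.update (interp e) y (some p)) := fun p δ => by
      rw [← Formula.decorate_adjoin_mem_language hy _ ht, hR]
      rfl
    have huniq := hadm.2.2.2.existsUnique hfree ht e
    have hsat : ∀ p : t.Node, (φ _ (ch p.arity p.label (τ.toFun (t.decorate fun q =>
        adjoin y {z | e z = q} (q = p))))).Sat t (Function.update (interp e) y (some p)) :=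
      fun p => (hmem p _).1 (hch _ _ _ ((huniq p).exists.imp fun δ => (hmem p δ).2))
    constructor
    · rintro ⟨d', hd', hP⟩
      -- Determinism forces the relabelling provided by `Sat` to be the one computed with `ch`.
      rw [hK] at hP
      rwa [show d' = _ from funext fun p => (huniq p).unique (hd' p) (hsat p)] at hP
    · exact fun h => ⟨_, hsat, (hK _).2 h⟩
  refine ⟨blockHom σ τ b ch k, {x | ∃ h : x.1.rank = k, (x.1.F (.trivial _ h)).1 ∈ P ∧ D x.1.t.1},
    fun x hx => hx.1, ?_⟩
  ext s
  obtain ⟨t, d, rfl⟩ := exists_decorate s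
  have hmem : t.decorate d ∈ (blockHom σ τ b ch k).toFun ⁻¹'
      {x | ∃ h : x.1.rank = k, (x.1.F (.trivial _ h)).1 ∈ P ∧ D x.1.t.1} ↔
      ∃ h : (blockVal σ.toHom τ.toHom k b ch t d).rank = k,
        ((blockVal σ.toHom τ.toHom k b ch t d).F (.trivial _ h)).1 ∈ P ∧
          D (blockVal σ.toHom τ.toHom k b ch t d).t.1 := by
    rw [← blockHom_decorate]
    rfl
  refine Iff.trans ?_ hmem.symm
  have hDt : t.rank = k → (D (blockVal σ.toHom τ.toHom k b ch t d).t.1 ↔ IsStructure d) := fun ht =>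
    (iff_of_eq (congrArg D (blockVal_t σ.toHom τ.toHom k b ch t d))).trans (hD t ht d)
  rw [Formula.decorate_mem_language]
  constructor
  · rintro ⟨ht, e, hd, hs⟩
    exact ⟨(rank_blockVal _ _ _ _ _ _ _).trans ht, (key t ht d e hd).1 hs, (hDt ht).2 ⟨e, hd⟩⟩
  · rintro ⟨h, hP, hs⟩
    have ht := (rank_blockVal _ _ _ _ _ _ _).symm.trans h
    obtain ⟨e, hd⟩ := (hDt ht).1 hs
    exact ⟨ht, e, hd, (key t ht d e hd).2 hP⟩

end Block

/-! ### Testing whether a decorated tree is a structure. -/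

section Cases

open RTree

/-- Adding a root, and further subtrees, without elements of `Y` in the labels. -/
theorem isStructure_graft_iff {Sg : ℕ → Type} {V : Type} {Y : Finset V} {n : ℕ} (a : Sg (n + 1)) (ts : Fin (n + 1) → RTree Sg)
    (d : (node a ts).Node → Set Y) (hr : d (.root a ts) = ∅)
    (hd : ∀ i x, i ≠ 0 → d (.child a ts i x) = ∅) :
    IsStructure d ↔ IsStructure fun x => d (.child a ts 0 x) := by
  constructor
  · rintro ⟨e, he⟩
    have hz : ∀ z, ∃ x, e z = .child a ts 0 x := fun z => by
      -- Each `z` occurs in the label of `e z`, which excludes the root and the other subtrees,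
      -- whose labels are empty.
      have hz : z ∈ d (e z) := by rw [he]; rfl
      generalize e z = p at hz
      cases p with
      | root => rw [hr] at hz; exact hz.elim
      | child _ _ i x =>
        by_cases hi : i = 0
        · subst hi; exact ⟨x, rfl⟩
        · rw [hd i x hi] at hz; exact hz.elim
    choose e' he' using hz
    refine ⟨e', fun x => ?_⟩
    ext z
    simp [he, he']
  · rintro ⟨e, he⟩
    refine ⟨fun z => .child a ts 0 (e z), fun p => ?_⟩
    cases p with
    | root => simp [hr]
    | child _ _ i x =>
      by_cases hi : i = 0
      · subst hi; simp [he]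
      · rw [hd i x hi]
        ext z
        simp [Ne.symm hi]

variable {Sg Δ : ℕ → Type} {V : Type} [DecidableEq V] {Y : Finset V} {y : V} {k : ℕ}
  {φ : ∀ n, Δ n → Formula Sg V k}

/-- A deterministic family singles out the structures. -/
theorem exists_mem_language_iff (hy : y ∉ Y) (hφ : Formula.Deterministic φ y)
    (hfree : ∀ n δ, (φ n δ).freeVars ⊆ (insert y Y : Finset V))
    {t : RTree Sg} (ht : t.rank = k) (d : t.Node → Set Y) (p : t.Node) :
    (∃ δ, (t.decorate fun q => adjoin y (d q) (q = p)) ∈ (φ p.arity δ).language (insert y Y)) ↔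
      IsStructure d := by
  constructor
  · rintro ⟨δ, h⟩
    exact Formula.isStructure_of_mem_language hy h
  · rintro ⟨e, he⟩
    obtain rfl : d = fun p => {z | e z = p} := funext he
    obtain ⟨δ, h, -⟩ := hφ.existsUnique hfree ht e p
    exact ⟨δ, (Formula.decorate_adjoin_mem_language hy _ ht e p).2 h⟩

end Cases

end TreeLogic

/-! ### The test for structures, according to the available letters. -/

open TreeLogic in
theorem mainTheorem10 {Sg Δ : ℕ → Type} (hSg : Finite (Σ n, Sg n))
    {V : Type} [DecidableEq V] {k : ℕ} (Y : Finset V) (y : V) (hy : y ∉ Y)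
    (φ : ∀ n, Δ n → Formula Sg V k) (hφ : ∀ n δ, (φ n δ).IsLind)
    (hfree : ∀ n δ, (φ n δ).freeVars ⊆ (insert y Y : Finset V))
    (K : Set (RTree Δ)) (hadm : Formula.Admissible Δ K y φ)
    (hletter : Y = ∅ ∨ ∃ n ≤ 1, Nonempty (Sg n))
    (S : PGPair.{u}) (hS : S.Recognizes (X := RTree.pgPair Δ) k K)
    (T : PGPair.{v})
    (hT : ∃ τ : PGPair.Hom (RTree.pgPair (Ext Sg (insert y Y))) T,
      ∀ n δ, τ.Recognizes k ((φ n δ).language (insert y Y))) :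
    (S.blockProduct T k).Recognizes (X := RTree.pgPair (Ext Sg Y)) k
        ((Formula.quant Δ K y φ).language Y) ∧
      (S.Finitary → T.Finitary → (S.blockProduct T k).Finitary) := by
  refine ⟨?_, fun hS hT => hS.blockProduct hT k⟩
  obtain ⟨σ, hσ⟩ := hS
  obtain ⟨τ, hτ⟩ := hT
  choose R hRk hR using hτ
  have hmem : ∀ n δ s, s ∈ (φ n δ).language (insert y Y) ↔ τ.toFun s ∈ R n δ := fun n δ s => by
    rw [hR]; rfl
  have hτ : ∀ n δ, τ.Recognizes k ((φ n δ).language (insert y Y)) := fun n δ => ⟨R n δ, hRk n δ, hR n δ⟩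
  have hdet := hadm.2.2.2
  by_cases hY : Y = ∅
  · subst hY
    refine quant_language_recognized σ τ False hy hfree hadm hσ hτ (by simp) (fun _ => True) ?_
    refine fun t _ d => iff_of_true _root_.trivial ⟨fun z => (Finset.notMem_empty _ z.2).elim, fun p => ?_⟩
    exact Set.ext fun z => (Finset.notMem_empty _ z.2).elim
  have hletter := hletter.resolve_left hY
  -- The subtrees `w` must have rank 0 so that grafting preserves the rank `k` at which the `φ_δ`
  -- are interpreted. A rank 1 letter needs no `w`; otherwise a rank 0 letter fills the remaining
  -- places below any letter of positive rank.
  have hgraft : (∃ (n : ℕ) (_ : Sg (n + 1)) (w : Fin n → RTree Sg), ∀ i, (w i).rank = 0) ∨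
      ∀ n, Sg n → n = 0 := by
    obtain ⟨n, hn, ⟨c⟩⟩ := hletter
    interval_cases n
    · by_cases h : ∃ n, Nonempty (Sg (n + 1))
      · obtain ⟨n, ⟨a⟩⟩ := h
        exact .inl ⟨n, a, fun _ => .node c Fin.elim0, fun _ => by simp [RTree.rank]⟩
      · refine .inr fun n a => ?_
        rcases n with _ | n
        · rfl
        · exact absurd ⟨n, ⟨a⟩⟩ h
    · exact .inl ⟨0, c, Fin.elim0, fun i => i.elim0⟩
  rcases hgraft with ⟨n, a, w, hw⟩ | h0
  · refine quant_language_recognized σ τ False hy hfree hadm hσ hτ (by simp)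
      -- With `x` the value of the unmarked tree, this composite is the value of the grafted tree
      -- whose new root alone carries `y`.
      (fun x => ∃ δ, T.act (RTree.letterVal τ.toHom (Sg := Ext Sg (insert y Y)) (n := n + 1)
        (a, adjoin y (∅ : Set Y) True)) (Fin.cons x fun i => τ.toFun
          ((w i).decorate fun _ => adjoin y (∅ : Set Y) False)) ∈ R (n + 1) δ) ?_
    intro t ht d
    let ts : Fin (n + 1) → RTree Sg := Fin.cons t w
    let f : ∀ i, (ts i).Node → Set Y :=
      Fin.cases (motive := fun i => (ts i).Node → Set Y) d fun _ _ => ∅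
    let d' : (RTree.node a ts).Node → Set Y := fun
      | .root _ _ => ∅
      | .child _ _ i x => f i x
    have hts : (RTree.node a ts).rank = k := by
      simp [RTree.rank, Fin.sum_univ_succ, ts, hw, ht]
    have h := exists_mem_language_iff hy hdet hfree hts d' (.root a ts)
    rw [isStructure_graft_iff a ts d' rfl fun i x hi => by
      cases i using Fin.cases with
      | zero => exact absurd rfl hi
      | succ i => rfl] at h
    refine Iff.trans (exists_congr fun δ => ?_) h
    refine Iff.trans ?_ (hmem _ _ _).symm
    refine iff_of_eq (congrArg (· ∈ R (n + 1) δ) ?_)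
    refine Eq.trans ?_ (map_decorate_node τ.toHom a ts _).symm
    refine T.act_congr (by simp only [eq_self]; rfl) fun i i' hi => ?_
    obtain rfl := Fin.ext hi
    simp only [reduceCtorEq]
    cases i using Fin.cases <;> rfl
  -- With letters of rank 0 only, a tree is a variable or a single node, so marking every node marks
  -- just that one.
  · have hsub : ∀ {t : RTree Sg} (p q : t.Node), q = p := by
      rintro _ (⟨a, ts⟩ | ⟨a, ts, i, x⟩) q
      · obtain rfl := h0 _ a
        cases q with
        | root => rfl
        | child _ _ i => exact i.elim0
      · obtain rfl := h0 _ a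
        exact i.elim0
    refine quant_language_recognized σ τ True hy hfree hadm hσ hτ
      (fun _ _ p q => iff_of_true (.inr _root_.trivial) (hsub p q)) (fun x => ∃ δ, x ∈ R 0 δ) ?_
    refine fun t ht d => ⟨fun ⟨δ, h⟩ => ?_, fun h => ?_⟩
    · exact Formula.isStructure_of_mem_language hy ((hmem _ _ _).2 h)
    · cases t with
      | var =>
        -- The tree `var` has no node to interpret an element of the nonempty set `Y`, hence is not
        -- a structure.
        obtain ⟨e, -⟩ := h
        obtain ⟨z, hz⟩ := Finset.nonempty_iff_ne_empty.2 hY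
        exact nomatch e ⟨z, hz⟩
      | node a ts =>
        obtain rfl := h0 _ a
        obtain ⟨δ, h⟩ := (exists_mem_language_iff hy hdet hfree ht d (.root a ts)).2 h
        rw [show (fun q => adjoin y (d q) (q = .root a ts)) = fun q => adjoin y (d q) True from
          funext fun q => congrArg _ (eq_true (hsub _ q))] at h
        exact ⟨δ, (hmem _ _ _).1 h⟩
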